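/- Let $\mathcal{K}$ be a non-trivial compact connected metric graph: a connected multigraph (self-loops, multiple edges and vertices of any degree are allowed) with a finite, non-empty set $E_{\mathcal K}$ of edges, each edge $e$ being identified with an interval $I_e=[0,\ell_e]$, $0<\ell_e<\infty$. Let $\mathcal{G}$ be the metric graph obtained by attaching to vertices of $\mathcal{K}$ (not necessarily distinct) a finite number of half-lines, each identified with $[0,+\infty)$, with $0$ at the vertex of attachment; let $E$ be the set of all edges of $\mathcal{G}$, that is, $E_{\mathcal K}$ together with the half-lines, with $I_e=[0,+\infty)$ if $e$ is a half-line. Let $H^1(\mathcal{G})$ be the set of continuous functions $u:\mathcal{G}\to\mathbb{R}$ whose restriction $u_e$ to each edge $e\in E$ belongs to $H^1(I_e)$. Let $2<p<6$ and $\mu>0$, and put $$H^1_\mu(\mathcal{G})=\Big\{u\in H^1(\mathcal{G}) : \sum_{e\in E}\int_{I_e}|u_e|^2\,dx=\mu\Big\},\qquad E(u,\mathcal{G})=\frac12\sum_{e\in E}\int_{I_e}|u_e'|^2\,dx-\frac1p\sum_{e\in E_{\mathcal K}}\int_{I_e}|u_e|^p\,dx .$$ Then $$\inf_{u\in H^1_\mu(\mathcal{G})}E(u,\mathcal{G})\le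 0 .$$ Moreover, if $$\inf_{u\in H^1_\mu(\mathcal{G})}E(u,\mathcal{G})<0 ,$$ then the infimum is attained (in particular it is finite) and, up to a change of sign, every minimizer is strictly positive: if $u$ is a minimizer, then either $u>0$ everywhere on $\mathcal{G}$ or $u<0$ everywhere on $\mathcal{G}$. -/

import Mathlib

open Set MeasureTheory
open scoped ContDiff

noncomputable section

/-- A compact connected metric graph `K` with vertex set `V` and (bounded) edge set `E`, together
with half-lines indexed by `H` attached at vertices of `K`. Self-loops, multiple edges and vertices
of any degree are allowed. The edge `e` is identified with `[0, length e]`, the point `0` being the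
vertex `src e` and the point `length e` being the vertex `tgt e`; the half-line `h` is identified
with `[0, ∞)`, the point `0` being the vertex `root h`. `K` is non-trivial (it has an edge) and
connected; compactness of `K` and finiteness of the number of half-lines are the finiteness of `E`
and `H`, which is assumed where these structures are used (`V` is then finite by connectedness). -/
structure MetricGraph (V E H : Type*) where
  src : E → V
  tgt : E → V
  length : E → ℝ
  length_pos : ∀ e, 0 < length e
  nontrivial : Nonempty E
  connected : ∀ v w : V, Relation.EqvGen (fun a b => ∃ e, src e = a ∧ tgt e = b) v w
  root : H → V

namespace MetricGraph

variable {V E H : Type*} (G : MetricGraph V E H)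

/-- The disjoint union of the intervals `[0, length e]` and of the half-lines `[0, ∞)`. -/
abbrev PrePoint : Type _ :=
  (Σ e : E, Icc (0 : ℝ) (G.length e)) ⊕ (Σ _ : H, Ici (0 : ℝ))

/-- `G.IsEnd a v`: the point `a` of the disjoint union is an endpoint lying at the vertex `v`. -/
inductive IsEnd : G.PrePoint → V → Prop
  | src (e : E) : IsEnd (Sum.inl ⟨e, 0, le_refl 0, (G.length_pos e).le⟩) (G.src e)
  | tgt (e : E) : IsEnd (Sum.inl ⟨e, G.length e, (G.length_pos e).le, le_refl _⟩) (G.tgt e)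
  | root (h : H) : IsEnd (Sum.inr ⟨h, 0, self_mem_Ici⟩) (G.root h)

/-- Two endpoints are glued when they lie at the same vertex. -/
def Glue (a b : G.PrePoint) : Prop := ∃ v, G.IsEnd a v ∧ G.IsEnd b v

/-- The metric graph as a topological space: the disjoint union of its edges, with endpoints at the
same vertex identified, carrying the quotient topology. (Vertices at infinity are not points.) -/
def Point : Type _ := Quot G.Glue

instance : TopologicalSpace G.Point := inferInstanceAs (TopologicalSpace (Quot G.Glue))

/-- The point with coordinate `x ∈ [0, length e]` on the bounded edge `e` (`x` is clamped to this
interval when it lies outside). -/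
def edgePt (e : E) (x : ℝ) : G.Point :=
  Quot.mk _ (Sum.inl ⟨e, projIcc 0 (G.length e) (G.length_pos e).le x⟩)

/-- The point with coordinate `x ∈ [0, ∞)` on the half-line `h` (`x` is clamped to this interval
when it lies outside). -/
def rayPt (h : H) (x : ℝ) : G.Point :=
  Quot.mk _ (Sum.inr ⟨h, projIci 0 x⟩)

end MetricGraph

/-- `g` is a weak derivative of `f` on the open set `s ⊆ ℝ`. -/
def HasWeakDerivOn (f g : ℝ → ℝ) (s : Set ℝ) : Prop :=
  LocallyIntegrableOn f s ∧ LocallyIntegrableOn g s ∧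
    ∀ φ : ℝ → ℝ, ContDiff ℝ ∞ φ → HasCompactSupport φ → tsupport φ ⊆ s →
      ∫ x in s, f x * deriv φ x = - ∫ x in s, g x * φ x

open Classical in
/-- The weak derivative of `f` on the open set `s` (unique up to a.e. equality on `s` when it
exists; `0` when there is none). -/
def weakDerivOn (f : ℝ → ℝ) (s : Set ℝ) : ℝ → ℝ :=
  if h : ∃ g, HasWeakDerivOn f g s then Classical.choose h else 0

/-- `f ∈ H¹(s)`: `f ∈ L²(s)` has a weak derivative on `s` that belongs to `L²(s)`. -/
def MemH1On (f : ℝ → ℝ) (s : Set ℝ) : Prop :=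
  MemLp f 2 (volume.restrict s) ∧
    ∃ g, HasWeakDerivOn f g s ∧ MemLp g 2 (volume.restrict s)

namespace MetricGraph

variable {V E H : Type*} (G : MetricGraph V E H)

/-- The restriction `u_e` of `u` to the bounded edge `e`. -/
def onEdge (u : G.Point → ℝ) (e : E) : ℝ → ℝ := fun x => u (G.edgePt e x)

/-- The restriction `u_h` of `u` to the half-line `h`. -/
def onRay (u : G.Point → ℝ) (h : H) : ℝ → ℝ := fun x => u (G.rayPt h x)

/-- `H¹(G)`: the functions that are continuous on `G` and whose restriction to every edge
is an `H¹` function. -/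
def H1 : Set (G.Point → ℝ) :=
  {u | Continuous u ∧ (∀ e, MemH1On (G.onEdge u e) (Ioo 0 (G.length e))) ∧
    ∀ h, MemH1On (G.onRay u h) (Ioi 0)}

variable [Fintype E] [Fintype H]

/-- The mass `‖u‖²` in `L²(G)`. -/
def mass (u : G.Point → ℝ) : ℝ :=
  (∑ e, ∫ x in Ioo 0 (G.length e), |G.onEdge u e x| ^ 2) + ∑ h, ∫ x in Ioi 0, |G.onRay u h x| ^ 2

/-- The Dirichlet integral `‖u'‖²` in `L²(G)`. -/
def dirichlet (u : G.Point → ℝ) : ℝ :=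
  (∑ e, ∫ x in Ioo 0 (G.length e), |weakDerivOn (G.onEdge u e) (Ioo 0 (G.length e)) x| ^ 2) +
    ∑ h, ∫ x in Ioi 0, |weakDerivOn (G.onRay u h) (Ioi 0) x| ^ 2

/-- The energy `E(u, G) = (1/2) ‖u'‖²_{L²(G)} - (1/p) ‖u‖^p_{L^p(K)}`, whose nonlinear term only
involves the bounded edges. -/
def energy (p : ℝ) (u : G.Point → ℝ) : ℝ :=
  (1 / 2) * G.dirichlet u - (1 / p) * ∑ e, ∫ x in Ioo 0 (G.length e), |G.onEdge u e x| ^ p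

/-- The constraint set `H¹_μ(G)` of the `H¹` functions of mass `μ`. -/
def H1Mass (μ : ℝ) : Set (G.Point → ℝ) := {u | u ∈ G.H1 ∧ G.mass u = μ}

/-- The infimum of the energy over `H¹_μ(G)`, in the extended reals (so that it is `-∞` when the
energy is unbounded below, and `+∞` when the constraint set is empty). -/
def infEnergy (p μ : ℝ) : EReal := ⨅ u ∈ G.H1Mass μ, (G.energy p u : EReal)

/-- `u` minimizes the energy over `H¹_μ(G)`. -/
def IsMinimizer (p μ : ℝ) (u : G.Point → ℝ) : Prop :=
  u ∈ G.H1Mass μ ∧ (G.energy p u : EReal) = G.infEnergy p μ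

end MetricGraph

end

/-! ### Intervals and half-lines; absolute continuity; weak derivatives -/

section Arc

open Filter Topology

/-! The infimum is nonpositive because mass can be spread along the half-lines: `expCutoff ε` is 1
on the compact core and decays exponentially on the half-lines, so after rescaling to mass `μ` its
kinetic energy tends to 0 with `ε`, while the potential term only lowers the energy. Without
half-lines it is a constant function (`infEnergy_nonpos`).

Existence is the direct method. The Gagliardo–Nirenberg bound `exists_sq_le` and `p < 6` make the
energy coercive at fixed mass (`exists_dirichlet_le`). A minimizing sequence has a limit `v` along
an ultrafilter; mass and Dirichlet integral are lower semicontinuous (`IsArc.arcH1_limit`), and the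
potential converges because it lives on bounded edges. Mass may escape along the half-lines, but a
negative infimum forces `v ≠ 0`, and since `p > 2` scaling `v` up to mass `μ` keeps the energy at or
below the infimum (`exists_isMinimizer`).

For positivity, `|u|` is again a minimizer. Comparing it with the rescaled `|u| + cφ`, `φ ≥ 0`,
shows that it is a weak supersolution of `-w'' + λw = 0` (`IsMinimizer.supersolution`); neither an
Euler–Lagrange equation nor vertex conditions are needed. Testing with `η² / (|u| + ε)` bounds the
weighted `L²` norm of the derivative of `log (|u| + ε)` uniformly in `ε`, so a zero would spread
along each arc and then, by connectedness, to the whole graph, against `μ > 0`. Hence `u` has no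
zero and keeps one sign.

Throughout, weak derivatives are traded for classical derivatives of absolutely continuous
functions, arc by arc (`mem_H1_iff`, `dirichlet_eq`). -/

/-- `s` is the interior and `t` the set of all points of an arc: a bounded interval or a
half-line starting at `0`. -/
def IsArc (s t : Set ℝ) : Prop :=
  (∃ l : ℝ, 0 < l ∧ s = Ioo 0 l ∧ t = Icc 0 l) ∨ (s = Ioi 0 ∧ t = Ici 0)

namespace IsArc

variable {s t : Set ℝ}

theorem isOpen (h : IsArc s t) : IsOpen s := by
  obtain ⟨l, -, rfl, rfl⟩ | ⟨rfl, rfl⟩ := h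
  exacts [isOpen_Ioo, isOpen_Ioi]

theorem measurableSet (h : IsArc s t) : MeasurableSet s := h.isOpen.measurableSet

theorem subset (h : IsArc s t) : s ⊆ t := by
  obtain ⟨l, -, rfl, rfl⟩ | ⟨rfl, rfl⟩ := h
  exacts [Ioo_subset_Icc_self, Ioi_subset_Ici_self]

theorem zero_mem (h : IsArc s t) : (0 : ℝ) ∈ t := by
  obtain ⟨l, hl, rfl, rfl⟩ | ⟨rfl, rfl⟩ := h
  exacts [⟨le_rfl, hl.le⟩, mem_Ici.2 le_rfl]

theorem nonneg (h : IsArc s t) {x : ℝ} (hx : x ∈ t) : 0 ≤ x := by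
  obtain ⟨l, hl, rfl, rfl⟩ | ⟨rfl, rfl⟩ := h
  exacts [hx.1, hx]

theorem ordConnected (h : IsArc s t) : OrdConnected t := by
  obtain ⟨l, hl, rfl, rfl⟩ | ⟨rfl, rfl⟩ := h
  exacts [ordConnected_Icc, ordConnected_Ici]

theorem ordConnected_interior (h : IsArc s t) : OrdConnected s := by
  obtain ⟨l, hl, rfl, rfl⟩ | ⟨rfl, rfl⟩ := h
  exacts [ordConnected_Ioo, ordConnected_Ioi]

theorem uIcc_subset (h : IsArc s t) {x y : ℝ} (hx : x ∈ t) (hy : y ∈ t) : uIcc x y ⊆ t :=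
  h.ordConnected.uIcc_subset hx hy

theorem Ioo_subset (h : IsArc s t) {x y : ℝ} (hx : x ∈ t) (hy : y ∈ t) : Ioo x y ⊆ s := by
  obtain ⟨l, hl, rfl, rfl⟩ | ⟨rfl, rfl⟩ := h
  · exact fun z hz => ⟨hx.1.trans_lt hz.1, hz.2.trans_le hy.2⟩
  · exact fun z hz => lt_of_le_of_lt hx hz.1

theorem exists_pos (h : IsArc s t) : ∃ d ∈ t, 0 < d := by
  obtain ⟨l, hl, rfl, rfl⟩ | ⟨rfl, rfl⟩ := h
  exacts [⟨l, ⟨hl.le, le_rfl⟩, hl⟩, ⟨1, mem_Ici.2 zero_le_one, one_pos⟩]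

theorem subset_closure (h : IsArc s t) : t ⊆ closure s := by
  obtain ⟨l, hl, rfl, rfl⟩ | ⟨rfl, rfl⟩ := h
  exacts [(closure_Ioo hl.ne).ge, closure_Ioi (0 : ℝ) |>.ge]

theorem exists_mono_exhaustion (h : IsArc s t) :
    ∃ r : ℕ → ℝ, Monotone r ∧ (∀ n, r n ∈ t) ∧ s = ⋃ n, Ioo 0 (r n) := by
  obtain ⟨l, hl, rfl, rfl⟩ | ⟨rfl, rfl⟩ := h
  · exact ⟨fun _ => l, monotone_const, fun _ => ⟨hl.le, le_rfl⟩, by simp [iUnion_const]⟩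
  · refine ⟨fun n => n, Nat.mono_cast, fun n => mem_Ici.2 n.cast_nonneg, ?_⟩
    ext x
    simp only [mem_Ioi, mem_iUnion, mem_Ioo, exists_and_left]
    exact ⟨fun hx => ⟨hx, exists_nat_gt x⟩, fun hx => hx.1⟩

/-- A compact subset of the interior is contained in an initial interval of the arc. -/
theorem exists_mem_Ioo (h : IsArc s t) {K : Set ℝ} (hK : IsCompact K) (hKs : K ⊆ s) :
    ∃ b ∈ t, 0 < b ∧ K ⊆ Ioo 0 b := by
  obtain ⟨l, hl, rfl, rfl⟩ | ⟨rfl, rfl⟩ := h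
  · exact ⟨l, ⟨hl.le, le_rfl⟩, hl, hKs⟩
  · obtain ⟨b, hb⟩ := hK.bddAbove
    refine ⟨max b 0 + 1, ?_, ?_, fun x hx => ⟨hKs hx, ?_⟩⟩
    · simp only [mem_Ici]; positivity
    · positivity
    · linarith [hb hx, le_max_left b 0]

/-- Countably many initial intervals exhaust the interior, so local almost everywhere statements
become global even on a half-line. -/
theorem ae_restrict (h : IsArc s t) {P : ℝ → Prop}
    (hP : ∀ x ∈ t, ∀ᵐ z, z ∈ Ioo 0 x → P z) : ∀ᵐ z ∂volume.restrict s, P z := by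
  obtain ⟨r, -, hrt, hs⟩ := h.exists_mono_exhaustion
  rw [ae_restrict_iff' h.measurableSet]
  filter_upwards [ae_all_iff.2 fun n => hP _ (hrt n)] with z hz hzs
  rw [hs] at hzs
  obtain ⟨n, hn⟩ := mem_iUnion.1 hzs
  exact hz n hn

end IsArc

/-- `f` is absolutely continuous on every compact interval with endpoints in `t`. -/
def LocallyACOn (f : ℝ → ℝ) (t : Set ℝ) : Prop :=
  ∀ x ∈ t, ∀ y ∈ t, AbsolutelyContinuousOnInterval f x y

namespace LocallyACOn

variable {s t : Set ℝ} {f g : ℝ → ℝ}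

theorem ae_differentiableAt (hf : LocallyACOn f t) (h : IsArc s t) :
    ∀ᵐ x ∂volume.restrict s, DifferentiableAt ℝ f x := by
  refine h.ae_restrict fun x hx => ?_
  filter_upwards [(hf 0 h.zero_mem x hx).ae_differentiableAt] with z hz hz'
  exact hz (Icc_subset_uIcc (Ioo_subset_Icc_self hz'))

theorem continuousOn (hf : LocallyACOn f t) (h : IsArc s t) : ContinuousOn f t := by
  intro x hx
  obtain ⟨l, hl, rfl, rfl⟩ | ⟨rfl, rfl⟩ := h
  · have := (hf 0 ⟨le_rfl, hl.le⟩ l ⟨hl.le, le_rfl⟩).continuousOn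
    rw [uIcc_of_le hl.le] at this
    exact this x hx
  · have hx' : (0 : ℝ) ≤ x := hx
    have := (hf 0 (mem_Ici.2 le_rfl) (x + 1) (mem_Ici.2 (by linarith))).continuousOn
    rw [uIcc_of_le (by linarith)] at this
    refine (this x ⟨hx', by linarith⟩).mono_of_mem_nhdsWithin ?_
    rw [← Ici_inter_Iic]
    exact inter_mem self_mem_nhdsWithin (mem_nhdsWithin_of_mem_nhds (Iic_mem_nhds (by linarith)))

theorem intervalIntegrable_deriv (hf : LocallyACOn f t) {x y : ℝ} (hx : x ∈ t) (hy : y ∈ t) :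
    IntervalIntegrable (deriv f) volume x y :=
  (hf x hx y hy).intervalIntegrable_deriv

theorem integral_deriv (hf : LocallyACOn f t) {x y : ℝ} (hx : x ∈ t) (hy : y ∈ t) :
    ∫ z in x..y, deriv f z = f y - f x :=
  (hf x hx y hy).integral_deriv_eq_sub

end LocallyACOn

theorem IsArc.locallyIntegrableOn {s t : Set ℝ} (h : IsArc s t) {f : ℝ → ℝ}
    (hf : ∀ x ∈ t, IntegrableOn f (Ioo 0 x)) : LocallyIntegrableOn f s := by
  rw [locallyIntegrableOn_iff h.isOpen.isLocallyClosed]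
  intro K hK hKc
  obtain ⟨b, hb, -, hKb⟩ := h.exists_mem_Ioo hKc hK
  exact (hf b hb).mono_set hKb

theorem IsArc.locallyIntegrableOn_of_intervalIntegrable {s t : Set ℝ} (h : IsArc s t) {f : ℝ → ℝ}
    (hf : ∀ x ∈ t, IntervalIntegrable f volume 0 x) : LocallyIntegrableOn f s :=
  h.locallyIntegrableOn fun x hx => ((intervalIntegrable_iff_integrableOn_Ioc_of_le
    (h.nonneg hx)).1 (hf x hx)).mono_set Ioo_subset_Ioc_self

theorem IsArc.intervalIntegrable_of_continuousOn {s t : Set ℝ} (h : IsArc s t) {f : ℝ → ℝ}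
    (hf : ContinuousOn f t) {x y : ℝ} (hx : x ∈ t) (hy : y ∈ t) :
    IntervalIntegrable f volume x y :=
  (hf.mono (h.uIcc_subset hx hy)).intervalIntegrable

/-- Integrals over an arc of functions vanishing outside of an initial interval. -/
theorem IsArc.setIntegral_eq {s t : Set ℝ} (h : IsArc s t) {f : ℝ → ℝ} {b : ℝ} (hb : b ∈ t)
    (hf : ∀ x, x ∉ Ioo 0 b → f x = 0) : ∫ x in s, f x = ∫ x in (0 : ℝ)..b, f x := by
  rw [intervalIntegral.integral_of_le (h.nonneg hb), integral_Ioc_eq_integral_Ioo]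
  exact (setIntegral_eq_of_subset_of_forall_sdiff_eq_zero h.measurableSet
    (h.Ioo_subset h.zero_mem hb) fun x hx => hf x hx.2)

/-- The test function lives inside some `Ioo 0 b`, so integration by parts on `[0, b]` has no
boundary terms. -/
theorem LocallyACOn.hasWeakDerivOn {s t : Set ℝ} {f : ℝ → ℝ} (hf : LocallyACOn f t)
    (h : IsArc s t) : HasWeakDerivOn f (deriv f) s := by
  refine ⟨h.locallyIntegrableOn_of_intervalIntegrable fun x hx =>
      h.intervalIntegrable_of_continuousOn (hf.continuousOn h) h.zero_mem hx,
    h.locallyIntegrableOn_of_intervalIntegrable fun x hx =>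
      hf.intervalIntegrable_deriv h.zero_mem hx, fun φ hφ hc hφs => ?_⟩
  obtain ⟨b, hb, hb0, hφb⟩ := h.exists_mem_Ioo hc hφs
  have h0 : ∀ x, x ∉ Ioo 0 b → φ x = 0 := fun x hx =>
    image_eq_zero_of_notMem_tsupport fun hx' => hx (hφb hx')
  have h0' : ∀ x, x ∉ Ioo 0 b → deriv φ x = 0 := fun x hx => by
    by_contra hne
    exact hx (hφb (support_deriv_subset (Function.mem_support.2 hne)))
  rw [h.setIntegral_eq hb fun x hx => by rw [h0' x hx, mul_zero],
    h.setIntegral_eq hb fun x hx => by rw [h0 x hx, mul_zero],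
    (hf 0 h.zero_mem b hb).integral_mul_deriv_eq_deriv_mul
      ((hφ.of_le (by simp)).contDiffOn.absolutelyContinuousOnInterval),
    h0 0 (by simp), h0 b (by simp)]
  simp

/-! ### Uniqueness of weak derivatives and absolutely continuous representatives -/

theorem MeasureTheory.LocallyIntegrableOn.integrable_mul_of_tsupport_subset {s : Set ℝ}
    {g φ : ℝ → ℝ} (hg : LocallyIntegrableOn g s) (hφ : Continuous φ) (hc : HasCompactSupport φ)
    (hφs : tsupport φ ⊆ s) : Integrable fun x => g x * φ x := by
  have := (hg.integrableOn_compact_subset hφs hc).mul_continuousOn hφ.continuousOn hc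
  refine (integrableOn_iff_integrable_of_support_subset fun x hx => ?_).1 this
  exact subset_tsupport _ (right_ne_zero_of_mul (Function.mem_support.1 hx))

theorem setIntegral_mul_eq_integral_of_tsupport_subset {s : Set ℝ} {g φ : ℝ → ℝ}
    (hφs : tsupport φ ⊆ s) : ∫ x in s, g x * φ x = ∫ x, g x * φ x :=
  setIntegral_eq_integral_of_forall_compl_eq_zero fun x hx => by
    rw [image_eq_zero_of_notMem_tsupport fun h => hx (hφs h), mul_zero]

/-- The fundamental lemma of the calculus of variations. -/
theorem ae_eq_zero_of_forall_integral_mul_eq_zero {s : Set ℝ} (hs : IsOpen s) {f : ℝ → ℝ}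
    (hf : LocallyIntegrableOn f s)
    (h : ∀ φ : ℝ → ℝ, ContDiff ℝ ∞ φ → HasCompactSupport φ → tsupport φ ⊆ s →
      ∫ x in s, f x * φ x = 0) : ∀ᵐ x ∂volume.restrict s, f x = 0 := by
  rw [ae_restrict_iff' hs.measurableSet]
  refine hs.ae_eq_zero_of_integral_contDiff_smul_eq_zero hf fun φ hφ hc hφs => ?_
  rw [← h φ hφ hc hφs, setIntegral_mul_eq_integral_of_tsupport_subset hφs]
  simp only [smul_eq_mul, mul_comm]

theorem HasWeakDerivOn.sub {s : Set ℝ} {f₁ f₂ g₁ g₂ : ℝ → ℝ}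
    (h₁ : HasWeakDerivOn f₁ g₁ s) (h₂ : HasWeakDerivOn f₂ g₂ s) :
    HasWeakDerivOn (fun x => f₁ x - f₂ x) (fun x => g₁ x - g₂ x) s := by
  refine ⟨h₁.1.sub h₂.1, h₁.2.1.sub h₂.2.1, fun φ hφ hc hφs => ?_⟩
  have hc' : HasCompactSupport (deriv φ) := hc.deriv
  have hφs' : tsupport (deriv φ) ⊆ s := (closure_minimal support_deriv_subset
    (isClosed_tsupport φ)).trans hφs
  have hd : Continuous (deriv φ) := hφ.continuous_deriv (by simp)
  have i₁ := (h₁.1.integrable_mul_of_tsupport_subset hd hc' hφs').restrict (s := s)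
  have i₂ := (h₂.1.integrable_mul_of_tsupport_subset hd hc' hφs').restrict (s := s)
  have j₁ := (h₁.2.1.integrable_mul_of_tsupport_subset hφ.continuous hc hφs).restrict (s := s)
  have j₂ := (h₂.2.1.integrable_mul_of_tsupport_subset hφ.continuous hc hφs).restrict (s := s)
  simp only [sub_mul]
  rw [integral_sub i₁ i₂, integral_sub j₁ j₂, h₁.2.2 φ hφ hc hφs, h₂.2.2 φ hφ hc hφs]
  ring

theorem HasWeakDerivOn.ae_eq {s : Set ℝ} (hs : IsOpen s) {f g₁ g₂ : ℝ → ℝ}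
    (h₁ : HasWeakDerivOn f g₁ s) (h₂ : HasWeakDerivOn f g₂ s) : g₁ =ᵐ[volume.restrict s] g₂ := by
  have h := h₁.sub h₂
  have := ae_eq_zero_of_forall_integral_mul_eq_zero hs h.2.1 fun φ hφ hc hφs => by
    have := h.2.2 φ hφ hc hφs
    simp only [sub_self, zero_mul, integral_zero] at this
    linarith
  filter_upwards [this] with x hx
  exact sub_eq_zero.1 hx

/-- A smooth function with support in the order connected set `s` and vanishing integral is the
derivative of a smooth function with compact support in `s`. -/
theorem exists_contDiff_deriv_eq {s : Set ℝ} (hs : OrdConnected s) {ζ : ℝ → ℝ}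
    (hζ : ContDiff ℝ ∞ ζ) (hc : HasCompactSupport ζ) (hζs : tsupport ζ ⊆ s)
    (h0 : ∫ x, ζ x = 0) :
    ∃ φ : ℝ → ℝ, ContDiff ℝ ∞ φ ∧ HasCompactSupport φ ∧ tsupport φ ⊆ s ∧ deriv φ = ζ := by
  rcases (tsupport ζ).eq_empty_or_nonempty with he | hne
  · rw [tsupport_eq_empty_iff] at he
    subst he
    refine ⟨0, contDiff_const, HasCompactSupport.zero, by simp, ?_⟩
    ext x; simp
  have ha := hc.isCompact.sInf_mem hne
  have hb := hc.isCompact.sSup_mem hne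
  set a := sInf (tsupport ζ) with ha'
  set b := sSup (tsupport ζ) with hb'
  have hsub : tsupport ζ ⊆ Icc a b := fun x hx =>
    ⟨csInf_le hc.isCompact.bddBelow hx, le_csSup hc.isCompact.bddAbove hx⟩
  have hab : a ≤ b := (hsub ha).2
  have hz : ∀ x, x ∉ Icc a b → ζ x = 0 := fun x hx =>
    image_eq_zero_of_notMem_tsupport fun h => hx (hsub h)
  have hderiv : ∀ x, HasDerivAt (fun x => ∫ z in a..x, ζ z) (ζ x) x := fun x =>
    intervalIntegral.integral_hasDerivAt_right (hζ.continuous.intervalIntegrable _ _)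
      hζ.continuous.stronglyMeasurable.stronglyMeasurableAtFilter hζ.continuous.continuousAt
  have hd : deriv (fun x => ∫ z in a..x, ζ z) = ζ := funext fun x => (hderiv x).deriv
  -- To the left of `a` the integrand vanishes; to the right of `b` the primitive equals the total
  -- integral of `ζ`, which is 0.
  have hsupp : Function.support (fun x => ∫ z in a..x, ζ z) ⊆ Icc a b := by
    intro x hx
    by_contra hxn
    refine hx ?_
    rcases lt_or_ge x a with hxa | hxa
    · refine (intervalIntegral.integral_congr_ae ?_).trans intervalIntegral.integral_zero
      have : ∀ᵐ z : ℝ, z ≠ a := by simp [ae_iff, measure_singleton]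
      filter_upwards [this] with z hz' hzm
      rw [uIoc_of_ge hxa.le] at hzm
      exact hz z fun h => hz' (le_antisymm hzm.2 h.1)
    · have hbx : b < x := by
        by_contra hcon
        exact hxn ⟨hxa, not_lt.1 hcon⟩
      have e1 : ∫ z in a..x, ζ z = ∫ z in Icc a x, ζ z := by
        rw [intervalIntegral.integral_of_le hxa, integral_Icc_eq_integral_Ioc]
      have e2 : ∫ z in Icc a x, ζ z = ∫ z, ζ z :=
        setIntegral_eq_integral_of_forall_compl_eq_zero fun z hzm => hz z fun h =>
          hzm ⟨h.1, h.2.trans hbx.le⟩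
      simp only [e1, e2, h0]
  have hts : tsupport (fun x => ∫ z in a..x, ζ z) ⊆ Icc a b := closure_minimal hsupp isClosed_Icc
  refine ⟨_, ?_, HasCompactSupport.of_support_subset_isCompact isCompact_Icc hsupp,
    hts.trans (hs.out (hζs ha) (hζs hb)), hd⟩
  rw [contDiff_infty_iff_deriv, hd]
  exact ⟨fun x => (hderiv x).differentiableAt, hζ⟩

theorem exists_contDiff_integral_eq_one {s : Set ℝ} (hs : IsOpen s) (hne : s.Nonempty) :
    ∃ ψ : ℝ → ℝ, ContDiff ℝ ∞ ψ ∧ HasCompactSupport ψ ∧ tsupport ψ ⊆ s ∧ ∫ x, ψ x = 1 := by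
  obtain ⟨c, hc⟩ := hne
  obtain ⟨ε, hε, hball⟩ := Metric.isOpen_iff.1 hs c hc
  let ψ : ContDiffBump c := ⟨ε / 4, ε / 2, by positivity, by linarith⟩
  refine ⟨ψ.normed volume, ψ.contDiff_normed, ψ.hasCompactSupport_normed, ?_,
    ψ.integral_normed⟩
  rw [ψ.tsupport_normed_eq]
  exact (Metric.closedBall_subset_ball (by change ε / 2 < ε; linarith)).trans hball

/-- A function with vanishing weak derivative is almost everywhere constant. -/
theorem HasWeakDerivOn.ae_eq_const {s : Set ℝ} (hs : IsOpen s) (ho : OrdConnected s)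
    (hne : s.Nonempty) {f g : ℝ → ℝ} (h : HasWeakDerivOn f g s)
    (hg : ∀ᵐ x ∂volume.restrict s, g x = 0) :
    ∃ c, ∀ᵐ x ∂volume.restrict s, f x = c := by
  obtain ⟨ψ, hψ, hψc, hψs, hψ1⟩ := exists_contDiff_integral_eq_one hs hne
  refine ⟨∫ x in s, f x * ψ x, ?_⟩
  set c := ∫ x in s, f x * ψ x with hc
  have hconst : LocallyIntegrableOn (fun _ : ℝ => c) s :=
    (locallyIntegrable_const c).locallyIntegrableOn s
  have := ae_eq_zero_of_forall_integral_mul_eq_zero hs (h.1.sub hconst) ?_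
  · filter_upwards [this] with x hx
    exact sub_eq_zero.1 hx
  intro η hη hηc hηs
  have iη := hη.continuous.integrable_of_hasCompactSupport hηc (μ := volume)
  have iψ := hψ.continuous.integrable_of_hasCompactSupport hψc (μ := volume)
  set k := ∫ x, η x with hk
  have hkψc : HasCompactSupport (fun x => k * ψ x) := hψc.mul_left
  have hkψs : tsupport (fun x => k * ψ x) ⊆ s := (tsupport_mul_subset_right).trans hψs
  -- Subtracting `k * ψ` removes the mean of `η`, so the difference is the derivative of an
  -- admissible test function.
  obtain ⟨φ, hφ, hφc, hφs, hd⟩ := exists_contDiff_deriv_eq (ζ := fun x => η x - k * ψ x) ho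
    (hη.sub (contDiff_const.mul hψ)) (hηc.sub hkψc)
    ((tsupport_sub _ _).trans (union_subset hηs hkψs)) (by
      rw [integral_sub iη (iψ.const_mul k), integral_const_mul, hψ1, hk]; ring)
  have key := h.2.2 φ hφ hφc hφs
  have h0 : ∫ x in s, g x * φ x = 0 := by
    rw [integral_congr_ae (g := fun _ => 0) (by filter_upwards [hg] with x hx; simp [hx])]
    simp
  have i1 := (h.1.integrable_mul_of_tsupport_subset hη.continuous hηc hηs).restrict (s := s)
  have i2 := (h.1.integrable_mul_of_tsupport_subset hψ.continuous hψc hψs).restrict (s := s)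
  rw [h0, hd, neg_zero] at key
  have e1 : ∀ x, f x * (η x - k * ψ x) = f x * η x - k * (f x * ψ x) := fun x => by ring
  simp only [e1] at key
  rw [integral_sub i1 (i2.const_mul k), integral_const_mul, ← hc] at key
  have e2 : ∀ x, (f x - c) * η x = f x * η x - c * η x := fun x => by ring
  simp only [Pi.sub_apply, e2]
  rw [integral_sub i1 (iη.const_mul c).restrict, integral_const_mul]
  have : ∫ x in s, η x = k := setIntegral_eq_integral_of_forall_compl_eq_zero fun x hx =>
    image_eq_zero_of_notMem_tsupport fun h => hx (hηs h)
  rw [this]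
  linarith

theorem IsArc.eqOn_of_ae_eq {s t : Set ℝ} (h : IsArc s t) {f g : ℝ → ℝ} (hf : ContinuousOn f t)
    (hg : ContinuousOn g t) (hfg : f =ᵐ[volume.restrict s] g) : EqOn f g t := by
  have := Measure.eqOn_open_of_ae_eq hfg h.isOpen (hf.mono h.subset) (hg.mono h.subset)
  exact this.of_subset_closure hf hg h.subset h.subset_closure

theorem IsArc.nonempty_interior {s t : Set ℝ} (h : IsArc s t) : s.Nonempty := by
  obtain ⟨d, hd, hd0⟩ := h.exists_pos
  exact (nonempty_Ioo.2 hd0).mono (h.Ioo_subset h.zero_mem hd)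

/-- A primitive of a locally integrable function. -/
theorem IsArc.primitive {s t : Set ℝ} (h : IsArc s t) {f g : ℝ → ℝ}
    (hg : ∀ x ∈ t, IntervalIntegrable g volume 0 x)
    (hf : ∀ x ∈ t, f x = f 0 + ∫ z in (0 : ℝ)..x, g z) :
    LocallyACOn f t ∧ deriv f =ᵐ[volume.restrict s] g := by
  have hgi : ∀ x ∈ t, ∀ y ∈ t, IntervalIntegrable g volume x y := fun x hx y hy =>
    (hg x hx).symm.trans (hg y hy)
  have heq : ∀ x ∈ t, ∀ y ∈ t, f y = f x + ∫ z in x..y, g z := fun x hx y hy => by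
    rw [hf x hx, hf y hy, add_assoc,
      intervalIntegral.integral_add_adjacent_intervals (hg x hx) (hgi x hx y hy)]
  constructor
  · intro x hx y hy
    have h1 := (hgi x hx y hy).absolutelyContinuousOnInterval_intervalIntegral left_mem_uIcc
    have h2 : AbsolutelyContinuousOnInterval (fun z => f x + ∫ w in x..z, g w) x y :=
      (LipschitzOnWith.absolutelyContinuousOnInterval (K := 0)
        (LipschitzWith.const (f x)).lipschitzOnWith).fun_add h1
    rw [absolutelyContinuousOnInterval_iff] at h2 ⊢
    intro ε hε
    obtain ⟨δ, hδ, h3⟩ := h2 ε hε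
    refine ⟨δ, hδ, fun E hE hE' => ?_⟩
    refine lt_of_eq_of_lt (Finset.sum_congr rfl fun i hi => ?_) (h3 E hE hE')
    have hm := hE.1 i (Finset.mem_range.1 hi |> Finset.mem_range.2)
    rw [heq x hx _ (h.uIcc_subset hx hy hm.1), heq x hx _ (h.uIcc_subset hx hy hm.2)]
  · refine h.ae_restrict fun x hx => ?_
    filter_upwards [(hg x hx).ae_hasDerivAt_integral] with z hz hzx
    have hz' : z ∈ uIcc 0 x := Icc_subset_uIcc (Ioo_subset_Icc_self hzx)
    have h1 := (hz hz' 0 left_mem_uIcc).const_add (f 0)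
    refine (h1.congr_of_eventuallyEq ?_).deriv
    filter_upwards [isOpen_Ioo.mem_nhds hzx] with w hw
    exact hf w (h.subset (h.Ioo_subset h.zero_mem hx hw))

/-- A continuous function with an integrable weak derivative is absolutely continuous. -/
theorem HasWeakDerivOn.locallyACOn {s t : Set ℝ} (h : IsArc s t) {f g : ℝ → ℝ}
    (hf : ContinuousOn f t) (hfg : HasWeakDerivOn f g s)
    (hg : ∀ x ∈ t, IntervalIntegrable g volume 0 x) :
    LocallyACOn f t ∧ deriv f =ᵐ[volume.restrict s] g := by
  set F : ℝ → ℝ := fun x => ∫ z in (0 : ℝ)..x, g z with hF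
  obtain ⟨hFac, hFd⟩ := h.primitive (f := F) hg fun x hx => by simp [hF]
  -- `f - F` has vanishing weak derivative, hence is constant almost everywhere, and by continuity
  -- everywhere on `t`.
  obtain ⟨c, hc⟩ := (hfg.sub (hFac.hasWeakDerivOn h)).ae_eq_const h.isOpen
    h.ordConnected_interior h.nonempty_interior (by
      filter_upwards [hFd] with x hx
      rw [hx, sub_self])
  have := h.eqOn_of_ae_eq (hf.sub (hFac.continuousOn h)) continuousOn_const hc
  refine h.primitive hg fun x hx => ?_
  have h1 := this hx
  have h2 := this h.zero_mem
  simp only [hF, Pi.sub_apply, intervalIntegral.integral_same] at h1 h2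
  linarith

/-- `weakDerivOn` is an arbitrary choice; uniqueness up to null sets makes integrals of it
computable from any known weak derivative. -/
theorem HasWeakDerivOn.weakDerivOn_ae_eq {s : Set ℝ} (hs : IsOpen s) {f g : ℝ → ℝ}
    (h : HasWeakDerivOn f g s) : weakDerivOn f s =ᵐ[volume.restrict s] g := by
  have hex : ∃ g, HasWeakDerivOn f g s := ⟨g, h⟩
  rw [weakDerivOn, dif_pos hex]
  exact hex.choose_spec.ae_eq hs h

/-- `H¹` functions on an arc, through their absolutely continuous representative. -/
structure ArcH1 (f : ℝ → ℝ) (s t : Set ℝ) : Prop where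
  ac : LocallyACOn f t
  memLp : MemLp f 2 (volume.restrict s)
  memLp_deriv : MemLp (deriv f) 2 (volume.restrict s)

theorem IsArc.intervalIntegrable_of_memLp {s t : Set ℝ} (h : IsArc s t) {g : ℝ → ℝ}
    (hg : MemLp g 2 (volume.restrict s)) {x y : ℝ} (hx : x ∈ t) (hy : y ∈ t) :
    IntervalIntegrable g volume x y := by
  wlog hxy : x ≤ y
  · exact (this h hg hy hx (le_of_not_ge hxy)).symm
  rw [intervalIntegrable_iff_integrableOn_Ioo_of_le hxy]
  have : MemLp g 2 (volume.restrict (Ioo x y)) :=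
    hg.mono_measure (Measure.restrict_mono (h.Ioo_subset hx hy) le_rfl)
  exact this.integrable (by norm_num)

theorem ArcH1.hasWeakDerivOn {f : ℝ → ℝ} {s t : Set ℝ} (h : IsArc s t) (hf : ArcH1 f s t) :
    HasWeakDerivOn f (deriv f) s :=
  hf.ac.hasWeakDerivOn h

theorem ArcH1.memH1On {f : ℝ → ℝ} {s t : Set ℝ} (h : IsArc s t) (hf : ArcH1 f s t) :
    MemH1On f s :=
  ⟨hf.memLp, _, hf.hasWeakDerivOn h, hf.memLp_deriv⟩

theorem MemH1On.arcH1 {f : ℝ → ℝ} {s t : Set ℝ} (h : IsArc s t) (hf : MemH1On f s)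
    (hc : ContinuousOn f t) : ArcH1 f s t := by
  obtain ⟨hf2, g, hg, hg2⟩ := hf
  obtain ⟨h1, h2⟩ := hg.locallyACOn h hc fun x hx =>
    h.intervalIntegrable_of_memLp hg2 h.zero_mem hx
  exact ⟨h1, hf2, hg2.ae_eq h2.symm⟩

theorem ArcH1.weakDerivOn_ae_eq {f : ℝ → ℝ} {s t : Set ℝ} (h : IsArc s t) (hf : ArcH1 f s t) :
    weakDerivOn f s =ᵐ[volume.restrict s] deriv f :=
  (hf.hasWeakDerivOn h).weakDerivOn_ae_eq h.isOpen

end Arc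

/-! ### Inequalities and operations for `H¹` functions on one arc -/

section ArcEstimates

open Filter Topology

section L2

variable {α : Type*} [MeasurableSpace α] {ν : Measure α} {f g : α → ℝ}

theorem MeasureTheory.MemLp.inner_toLp_eq_integral (hf : MemLp f 2 ν) (hg : MemLp g 2 ν) :
    inner ℝ (hf.toLp f) (hg.toLp g) = ∫ x, f x * g x ∂ν := by
  rw [L2.inner_def]
  refine integral_congr_ae ?_
  filter_upwards [hf.coeFn_toLp, hg.coeFn_toLp] with x h1 h2
  rw [h1, h2]
  simp [mul_comm]

theorem MeasureTheory.MemLp.norm_toLp_sq_eq_integral (hf : MemLp f 2 ν) :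
    ‖hf.toLp f‖ ^ 2 = ∫ x, f x ^ 2 ∂ν := by
  rw [← real_inner_self_eq_norm_sq, hf.inner_toLp_eq_integral]
  simp only [sq]

theorem MeasureTheory.MemLp.norm_toLp_eq_sqrt_integral (hf : MemLp f 2 ν) :
    ‖hf.toLp f‖ = √(∫ x, f x ^ 2 ∂ν) := by
  rw [← hf.norm_toLp_sq_eq_integral, Real.sqrt_sq (norm_nonneg _)]

theorem abs_integral_mul_le_sqrt_mul_sqrt (hf : MemLp f 2 ν) (hg : MemLp g 2 ν) :
    |∫ x, f x * g x ∂ν| ≤ √(∫ x, f x ^ 2 ∂ν) * √(∫ x, g x ^ 2 ∂ν) := by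
  rw [← hf.inner_toLp_eq_integral hg, ← hf.norm_toLp_eq_sqrt_integral,
    ← hg.norm_toLp_eq_sqrt_integral]
  exact abs_real_inner_le_norm _ _

theorem integral_abs_mul_le_sqrt_mul_sqrt (hf : MemLp f 2 ν) (hg : MemLp g 2 ν) :
    ∫ x, |f x * g x| ∂ν ≤ √(∫ x, f x ^ 2 ∂ν) * √(∫ x, g x ^ 2 ∂ν) := by
  have := abs_integral_mul_le_sqrt_mul_sqrt hf.abs hg.abs
  simp only [Pi.abs_apply, sq_abs, ← abs_mul] at this
  exact (le_abs_self _).trans this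

end L2

variable {s t : Set ℝ}

theorem IsArc.abs_intervalIntegral_le (h : IsArc s t) {F : ℝ → ℝ}
    (hF : IntegrableOn F s) {x y : ℝ} (hx : x ∈ t) (hy : y ∈ t) :
    |∫ z in x..y, F z| ≤ ∫ z in s, |F z| := by
  wlog hxy : x ≤ y generalizing x y
  · rw [intervalIntegral.integral_symm, abs_neg]
    exact this hy hx (le_of_not_ge hxy)
  rw [intervalIntegral.integral_of_le hxy, integral_Ioc_eq_integral_Ioo]
  exact abs_integral_le_integral_abs.trans (setIntegral_mono_set hF.abs
    (ae_of_all _ fun _ => abs_nonneg _) (LE.le.eventuallyLE (h.Ioo_subset hx hy)))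

/-- The Hölder estimate for a function with derivative in `L²`. -/
theorem AbsolutelyContinuousOnInterval.abs_sub_le_sqrt {f : ℝ → ℝ} {x y C : ℝ} (hxy : x ≤ y)
    (hf : AbsolutelyContinuousOnInterval f x y)
    (hd : MemLp (deriv f) 2 (volume.restrict (Ioo x y)))
    (hC : ∫ z in Ioo x y, deriv f z ^ 2 ≤ C) :
    |f y - f x| ≤ √(y - x) * √C := by
  rw [← hf.integral_deriv_eq_sub, intervalIntegral.integral_of_le hxy,
    integral_Ioc_eq_integral_Ioo]
  have h1 : MemLp (fun _ : ℝ => (1 : ℝ)) 2 (volume.restrict (Ioo x y)) := memLp_const 1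
  have := abs_integral_mul_le_sqrt_mul_sqrt h1 hd
  simp only [one_mul, one_pow, integral_const, smul_eq_mul, mul_one, measureReal_restrict_apply_univ,
    Real.volume_real_Ioo_of_le hxy] at this
  exact this.trans (by gcongr)

namespace ArcH1

variable {f g : ℝ → ℝ}

theorem integrableOn_sq (hf : ArcH1 f s t) : IntegrableOn (fun x => f x ^ 2) s :=
  hf.memLp.integrable_sq

theorem integrableOn_deriv_sq (hf : ArcH1 f s t) : IntegrableOn (fun x => deriv f x ^ 2) s :=
  hf.memLp_deriv.integrable_sq

theorem abs_sub_le (h : IsArc s t) (hf : ArcH1 f s t) {x y : ℝ} (hx : x ∈ t) (hy : y ∈ t) :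
    |f y - f x| ≤ √|y - x| * √(∫ z in s, deriv f z ^ 2) := by
  wlog hxy : x ≤ y generalizing x y
  · rw [abs_sub_comm (f y), abs_sub_comm y]
    exact this hy hx (le_of_not_ge hxy)
  rw [abs_of_nonneg (sub_nonneg.2 hxy)]
  refine (hf.ac x hx y hy).abs_sub_le_sqrt hxy
    (hf.memLp_deriv.mono_measure (Measure.restrict_mono (h.Ioo_subset hx hy) le_rfl)) ?_
  exact setIntegral_mono_set hf.integrableOn_deriv_sq (ae_of_all _ fun _ => sq_nonneg _)
    (LE.le.eventuallyLE (h.Ioo_subset hx hy))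

/-- The one-dimensional Gagliardo–Nirenberg inequality. -/
theorem sq_le (h : IsArc s t) (hf : ArcH1 f s t) {d : ℝ} (hd : d ∈ t) (hd0 : 0 < d) {x : ℝ}
    (hx : x ∈ t) :
    f x ^ 2 ≤ (∫ z in s, f z ^ 2) / d +
      2 * (√(∫ z in s, f z ^ 2) * √(∫ z in s, deriv f z ^ 2)) := by
  have hsub : Icc 0 d ⊆ t := h.ordConnected.out h.zero_mem hd
  have hcont : ContinuousOn (fun z => f z ^ 2) (Icc 0 d) :=
    ((hf.ac.continuousOn h).mono hsub).pow 2
  -- At a minimum point `y` of `f²` on `[0, d]`, `f y ^ 2` is at most the mean of `f²` there; the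
  -- passage from `y` to `x` costs the integral of `(f²)' = 2 f f'`, bounded by Cauchy–Schwarz.
  obtain ⟨y, hy, hmin⟩ := isCompact_Icc.exists_isMinOn (nonempty_Icc.2 hd0.le) hcont
  have h1 : f y ^ 2 ≤ (∫ z in s, f z ^ 2) / d := by
    rw [le_div_iff₀ hd0]
    have e1 : ∫ z in Ioo 0 d, f y ^ 2 = f y ^ 2 * d := by
      simp [hd0.le, mul_comm]
    rw [← e1]
    refine (setIntegral_mono_on (integrableOn_const (by simp)) (hcont.integrableOn_Icc.mono_set
      Ioo_subset_Icc_self) measurableSet_Ioo fun z hz => hmin (Ioo_subset_Icc_self hz)).trans ?_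
    exact setIntegral_mono_set hf.integrableOn_sq (ae_of_all _ fun _ => sq_nonneg _)
      (LE.le.eventuallyLE (h.Ioo_subset h.zero_mem hd))
  have hyt := hsub hy
  have h2 := AbsolutelyContinuousOnInterval.integral_deriv_mul_eq_sub (hf.ac y hyt x hx)
    (hf.ac y hyt x hx)
  have e2 : ∀ z, deriv f z * f z + f z * deriv f z = 2 * (f z * deriv f z) := fun z => by ring
  simp only [e2] at h2
  rw [intervalIntegral.integral_const_mul] at h2
  have hint : IntegrableOn (fun z => f z * deriv f z) s := hf.memLp.integrable_mul hf.memLp_deriv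
  have h3 := h.abs_intervalIntegral_le hint hyt hx
  have h4 := integral_abs_mul_le_sqrt_mul_sqrt hf.memLp hf.memLp_deriv
  have h5 := le_abs_self (∫ z in y..x, f z * deriv f z)
  nlinarith

theorem add_const_mul (h : IsArc s t) (hf : ArcH1 f s t) (hg : ArcH1 g s t) (c : ℝ) :
    ArcH1 (fun x => f x + c * g x) s t ∧
      deriv (fun x => f x + c * g x) =ᵐ[volume.restrict s] fun x => deriv f x + c * deriv g x := by
  have hd : deriv (fun x => f x + c * g x) =ᵐ[volume.restrict s]
      fun x => deriv f x + c * deriv g x := by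
    filter_upwards [hf.ac.ae_differentiableAt h, hg.ac.ae_differentiableAt h] with x h1 h2
    exact (h1.hasDerivAt.add (h2.hasDerivAt.const_mul c)).deriv
  exact ⟨⟨fun x hx y hy => (hf.ac x hx y hy).fun_add ((hg.ac x hx y hy).const_mul c),
    hf.memLp.add (hg.memLp.const_mul c),
    (hf.memLp_deriv.add (hg.memLp_deriv.const_mul c)).ae_eq hd.symm⟩, hd⟩

theorem const_mul (h : IsArc s t) (hf : ArcH1 f s t) (c : ℝ) :
    ArcH1 (fun x => c * f x) s t ∧
      deriv (fun x => c * f x) =ᵐ[volume.restrict s] fun x => c * deriv f x := by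
  have hd : deriv (fun x => c * f x) =ᵐ[volume.restrict s] fun x => c * deriv f x := by
    filter_upwards [hf.ac.ae_differentiableAt h] with x h1
    exact (h1.hasDerivAt.const_mul c).deriv
  exact ⟨⟨fun x hx y hy => (hf.ac x hx y hy).const_mul c, hf.memLp.const_mul c,
    (hf.memLp_deriv.const_mul c).ae_eq hd.symm⟩, hd⟩

end ArcH1

theorem LipschitzOnWith.comp_absolutelyContinuousOnInterval {f F : ℝ → ℝ} {S : Set ℝ}
    {K : NNReal} {a b : ℝ} (hF : LipschitzOnWith K F S) (hf : AbsolutelyContinuousOnInterval f a b)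
    (hS : MapsTo f (uIcc a b) S) : AbsolutelyContinuousOnInterval (fun x => F (f x)) a b := by
  rw [absolutelyContinuousOnInterval_iff] at hf ⊢
  intro ε hε
  -- `K + 1` instead of `K`, since `K` may be 0.
  obtain ⟨δ, hδ, h⟩ := hf (ε / (K + 1)) (by positivity)
  refine ⟨δ, hδ, fun E hE hE' => ?_⟩
  have := h E hE hE'
  rw [lt_div_iff₀ (by positivity)] at this
  refine lt_of_le_of_lt ?_ this
  rw [Finset.sum_mul]
  refine Finset.sum_le_sum fun i hi => ?_
  have hm := hE.1 i hi
  refine (hF.dist_le_mul _ (hS hm.1) _ (hS hm.2)).trans ?_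
  nlinarith [dist_nonneg (x := f (E.2 i).1) (y := f (E.2 i).2)]

theorem abs_deriv_abs_le {f : ℝ → ℝ} {x : ℝ} (hf : DifferentiableAt ℝ f x) :
    |deriv (fun y => |f y|) x| ≤ |deriv f x| := by
  rcases lt_trichotomy (f x) 0 with h | h | h
  · have : (fun y => |f y|) =ᶠ[𝓝 x] fun y => - f y := by
      filter_upwards [hf.continuousAt.eventually_lt continuousAt_const h] with y hy
      exact abs_of_neg hy
    rw [this.deriv_eq]
    simp
  -- At a zero of `f` the derivative of `|f|` is 0, either by Fermat's rule or as the default value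
  -- when `|f|` has a corner.
  · have : IsLocalMin (fun y => |f y|) x := Eventually.of_forall fun y => by simp [h]
    rw [this.deriv_eq_zero]
    simp
  · have : (fun y => |f y|) =ᶠ[𝓝 x] f := by
      filter_upwards [continuousAt_const.eventually_lt hf.continuousAt h] with y hy
      exact abs_of_pos hy
    rw [this.deriv_eq]

theorem ArcH1.abs {f : ℝ → ℝ} (h : IsArc s t) (hf : ArcH1 f s t) :
    ArcH1 (fun x => |f x|) s t ∧
      ∫ x in s, deriv (fun x => |f x|) x ^ 2 ≤ ∫ x in s, deriv f x ^ 2 := by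
  have hle : ∀ᵐ x ∂volume.restrict s, |deriv (fun x => |f x|) x| ≤ |deriv f x| := by
    filter_upwards [hf.ac.ae_differentiableAt h] with x hx using abs_deriv_abs_le hx
  have hm : MemLp (deriv fun x => |f x|) 2 (volume.restrict s) :=
    hf.memLp_deriv.of_le (measurable_deriv _).aestronglyMeasurable hle
  refine ⟨⟨fun x hx y hy => ?_, hf.memLp.abs, hm⟩, integral_mono_ae hm.integrable_sq
    hf.integrableOn_deriv_sq ?_⟩
  · refine LipschitzOnWith.comp_absolutelyContinuousOnInterval (F := fun x => |x|) (K := 1)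
      (S := univ) ?_ (hf.ac x hx y hy) (mapsTo_univ _ _)
    refine LipschitzWith.lipschitzOnWith (LipschitzWith.of_dist_le_mul fun a b => ?_)
    simpa [Real.dist_eq] using abs_abs_sub_abs_le_abs_sub a b
  · filter_upwards [hle] with x hx using sq_le_sq.2 hx

theorem IsArc.lipschitz_comp_ac (h : IsArc s t) {f F : ℝ → ℝ} {S : Set ℝ} {K : NNReal}
    (hF : LipschitzOnWith K F S) (hf : LocallyACOn f t) (hS : MapsTo f t S) :
    LocallyACOn (fun x => F (f x)) t := fun x hx y hy =>
  hF.comp_absolutelyContinuousOnInterval (hf x hx y hy) (hS.mono_left (h.uIcc_subset hx hy))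

/-- The shift by `ε` keeps nonnegative arguments away from the singularity, so composing with this
map preserves absolute continuity. -/
theorem lipschitzOnWith_inv_add {ε : ℝ} (hε : 0 < ε) :
    ∃ K, LipschitzOnWith K (fun y : ℝ => (y + ε)⁻¹) (Ici 0) := by
  refine ⟨((ε ^ 2)⁻¹).toNNReal, (convex_Ici 0).lipschitzOnWith_of_nnnorm_hasDerivWithin_le
    (f' := fun y => -((y + ε) ^ 2)⁻¹) (fun y hy => ?_) fun y hy => ?_⟩
  · have hy' : 0 < y + ε := by have : (0 : ℝ) ≤ y := hy; positivity
    have := (((hasDerivAt_id y).add_const ε).inv hy'.ne').hasDerivWithinAt (s := Ici 0)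
    convert! this using 1
    simp [neg_div]
  · have hy' : (0 : ℝ) ≤ y := hy
    rw [← NNReal.coe_le_coe, Real.coe_toNNReal _ (by positivity)]
    simp only [coe_nnnorm, norm_neg, norm_inv, norm_pow, Real.norm_eq_abs, sq_abs]
    gcongr
    linarith

theorem lipschitzOnWith_log_add {ε : ℝ} (hε : 0 < ε) :
    ∃ K, LipschitzOnWith K (fun y : ℝ => Real.log (y + ε)) (Ici 0) := by
  refine ⟨(ε⁻¹).toNNReal, (convex_Ici 0).lipschitzOnWith_of_nnnorm_hasDerivWithin_le
    (f' := fun y => (y + ε)⁻¹) (fun y hy => ?_) fun y hy => ?_⟩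
  · have hy' : 0 < y + ε := by have : (0 : ℝ) ≤ y := hy; positivity
    have := (((hasDerivAt_id y).add_const ε).log hy'.ne').hasDerivWithinAt (s := Ici 0)
    convert! this using 1
    simp
  · have hy' : (0 : ℝ) ≤ y := hy
    rw [← NNReal.coe_le_coe, Real.coe_toNNReal _ (by positivity)]
    simp only [coe_nnnorm, norm_inv, Real.norm_eq_abs]
    rw [abs_of_nonneg (by positivity)]
    gcongr
    linarith

/-- The test function `k² / (f + ε)`. -/
theorem ArcH1.sq_div_add (h : IsArc s t) {f k : ℝ → ℝ} (hf : ArcH1 f s t) (hk : ArcH1 k s t)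
    (hf0 : ∀ x ∈ t, 0 ≤ f x) (hk1 : ∀ x ∈ t, |k x| ≤ 1) {ε : ℝ} (hε : 0 < ε) :
    ArcH1 (fun x => k x ^ 2 * (f x + ε)⁻¹) s t ∧
      deriv (fun x => k x ^ 2 * (f x + ε)⁻¹) =ᵐ[volume.restrict s] fun x =>
        2 * k x * deriv k x * (f x + ε)⁻¹ - k x ^ 2 * deriv f x * ((f x + ε)⁻¹) ^ 2 := by
  obtain ⟨K, hK⟩ := lipschitzOnWith_inv_add hε
  have hinv := h.lipschitz_comp_ac hK hf.ac hf0
  have hac : LocallyACOn (fun x => k x ^ 2 * (f x + ε)⁻¹) t := fun x hx y hy => by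
    simp only [sq]
    exact ((hk.ac x hx y hy).fun_mul (hk.ac x hx y hy)).fun_mul (hinv x hx y hy)
  have hpos : ∀ x ∈ s, 0 < f x + ε := fun x hx => by have := hf0 x (h.subset hx); positivity
  have hinvle : ∀ x ∈ s, (f x + ε)⁻¹ ≤ ε⁻¹ := fun x hx => by
    have := hf0 x (h.subset hx)
    gcongr
    linarith
  have hd : deriv (fun x => k x ^ 2 * (f x + ε)⁻¹) =ᵐ[volume.restrict s] fun x =>
        2 * k x * deriv k x * (f x + ε)⁻¹ - k x ^ 2 * deriv f x * ((f x + ε)⁻¹) ^ 2 := by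
    filter_upwards [hf.ac.ae_differentiableAt h, hk.ac.ae_differentiableAt h,
      ae_restrict_mem h.measurableSet] with x h1 h2 hx
    have := ((h2.hasDerivAt.pow 2).mul ((h1.hasDerivAt.add_const ε).inv (hpos x hx).ne')).deriv
    convert! this using 1
    simp only [Nat.cast_ofNat, Nat.reduceSub, pow_one, Pi.inv_apply, Pi.pow_apply]
    rw [div_eq_mul_inv, inv_pow]
    ring
  refine ⟨⟨hac, ?_, ?_⟩, hd⟩
  · refine (hk.memLp.const_mul ε⁻¹).of_le
      ((hac.continuousOn h).mono h.subset |>.aestronglyMeasurable h.measurableSet) ?_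
    filter_upwards [ae_restrict_mem h.measurableSet] with x hx
    have h1 := hk1 x (h.subset hx)
    have h2 := hinvle x hx
    have h3 : 0 < (f x + ε)⁻¹ := inv_pos.2 (hpos x hx)
    rw [Real.norm_eq_abs, Real.norm_eq_abs, abs_mul, abs_mul, abs_of_pos h3,
      abs_of_pos (inv_pos.2 hε), abs_pow, mul_comm]
    gcongr
    nlinarith [abs_nonneg (k x)]
  · refine ((hk.memLp_deriv.abs.const_mul (2 * ε⁻¹)).add
      (hf.memLp_deriv.abs.const_mul (ε⁻¹ ^ 2))).of_le
      (measurable_deriv _).aestronglyMeasurable ?_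
    filter_upwards [hd, ae_restrict_mem h.measurableSet] with x hdx hx
    rw [hdx]
    have h1 := hk1 x (h.subset hx)
    have h2 := hinvle x hx
    have h3 : 0 < (f x + ε)⁻¹ := inv_pos.2 (hpos x hx)
    have h4 : k x ^ 2 ≤ 1 := by rw [← sq_abs]; exact pow_le_one₀ (abs_nonneg _) h1
    have h5 : 0 < ε⁻¹ := inv_pos.2 hε
    simp only [Pi.add_apply, Pi.abs_apply, Real.norm_eq_abs]
    rw [abs_of_nonneg (a := 2 * ε⁻¹ * _ + _) (by positivity)]
    refine (abs_sub _ _).trans (add_le_add ?_ ?_)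
    · rw [abs_mul, abs_mul, abs_mul, abs_two, abs_of_pos h3]
      calc 2 * |k x| * |deriv k x| * (f x + ε)⁻¹ ≤ 2 * 1 * |deriv k x| * ε⁻¹ := by gcongr
        _ = _ := by ring
    · rw [abs_mul, abs_mul, abs_of_nonneg (sq_nonneg (k x)), abs_of_pos (pow_pos h3 2)]
      calc k x ^ 2 * |deriv f x| * (f x + ε)⁻¹ ^ 2 ≤ 1 * |deriv f x| * ε⁻¹ ^ 2 := by gcongr
        _ = _ := by ring

/-- If the logarithmic derivatives of the functions `f + ε` are bounded in a weighted `L²` space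
uniformly in `ε`, then `f` vanishes everywhere or nowhere. -/
theorem ArcH1.eq_zero_of_log_deriv_bound (h : IsArc s t) {f k : ℝ → ℝ} (hf : ArcH1 f s t)
    (hf0 : ∀ x ∈ t, 0 ≤ f x) (hkc : ContinuousOn k t) (hk0 : ∀ x ∈ t, 0 < k x)
    {C : ℝ} (hC : ∀ ε > 0, ∫ x in s, (k x * deriv f x * (f x + ε)⁻¹) ^ 2 ≤ C)
    (hint : ∀ ε > 0, IntegrableOn (fun x => (k x * deriv f x * (f x + ε)⁻¹) ^ 2) s)
    {x y : ℝ} (hx : x ∈ t) (hy : y ∈ t) (hfx : f x = 0) : f y = 0 := by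
  -- On the compact segment between `x` and `y` the weight is at least `k m > 0`, so it can be
  -- divided out.
  obtain ⟨m, hm, hmin⟩ := isCompact_uIcc.exists_isMinOn nonempty_uIcc
    (hkc.mono (h.uIcc_subset hx hy))
  have hkm := hk0 m (h.uIcc_subset hx hy hm)
  have key : ∀ ε > 0, Real.log (f y + ε) - Real.log (f x + ε) ≤ √|y - x| * √(C / k m ^ 2) := by
    intro ε hε
    obtain ⟨K, hK⟩ := lipschitzOnWith_log_add hε
    have hac := h.lipschitz_comp_ac hK hf.ac hf0
    have hd : deriv (fun x => Real.log (f x + ε)) =ᵐ[volume.restrict s]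
        fun x => deriv f x * (f x + ε)⁻¹ := by
      filter_upwards [hf.ac.ae_differentiableAt h, ae_restrict_mem h.measurableSet] with z h1 hz
      have : 0 < f z + ε := by have := hf0 z (h.subset hz); positivity
      exact ((h1.hasDerivAt.add_const ε).log this.ne').deriv
    have hpt : ∀ a ∈ t, ∀ b ∈ t, Ioo a b ⊆ uIcc x y → ∀ᵐ z ∂volume.restrict (Ioo a b),
        deriv (fun x => Real.log (f x + ε)) z ^ 2 ≤
          (k z * deriv f z * (f z + ε)⁻¹) ^ 2 / k m ^ 2 := by
      intro a ha b hb hab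
      filter_upwards [ae_restrict_of_ae_restrict_of_subset (h.Ioo_subset ha hb) hd,
        ae_restrict_mem measurableSet_Ioo] with z hz hzm
      have hkz : k m ≤ k z := hmin (hab hzm)
      rw [hz, le_div_iff₀ (by positivity), ← mul_pow, sq_le_sq, mul_comm, mul_assoc, abs_mul,
        abs_mul (k z), abs_of_pos hkm, abs_of_pos (hkm.trans_le hkz)]
      gcongr
    have hmeas : Measurable (deriv fun x => Real.log (f x + ε)) := measurable_deriv _
    have hgen : ∀ a ∈ t, ∀ b ∈ t, a ≤ b → Ioo a b ⊆ uIcc x y →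
        |Real.log (f b + ε) - Real.log (f a + ε)| ≤ √(b - a) * √(C / k m ^ 2) := by
      intro a ha b hb hab hsub
      have hi : IntegrableOn (fun z => (k z * deriv f z * (f z + ε)⁻¹) ^ 2 / k m ^ 2)
        (Ioo a b) := ((hint ε hε).mono_set (h.Ioo_subset ha hb)).div_const _
      have hi' : IntegrableOn (fun z => deriv (fun x => Real.log (f x + ε)) z ^ 2) (Ioo a b) := by
        refine hi.mono' (hmeas.pow_const 2).aestronglyMeasurable ?_
        filter_upwards [hpt a ha b hb hsub] with z hz
        rwa [Real.norm_of_nonneg (sq_nonneg _)]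
      refine (hac a ha b hb).abs_sub_le_sqrt hab
        ((memLp_two_iff_integrable_sq hmeas.aestronglyMeasurable).2 hi') ?_
      refine (integral_mono_ae hi' hi (hpt a ha b hb hsub)).trans ?_
      rw [integral_div]
      gcongr
      exact (setIntegral_mono_set (hint ε hε) (ae_of_all _ fun _ => sq_nonneg _)
        (LE.le.eventuallyLE (h.Ioo_subset ha hb))).trans (hC ε hε)
    rcases le_total x y with hxy | hxy
    · rw [abs_of_nonneg (sub_nonneg.2 hxy)]
      exact (le_abs_self _).trans (hgen x hx y hy hxy
        (Ioo_subset_Icc_self.trans Icc_subset_uIcc))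
    · rw [abs_sub_comm, abs_of_nonneg (sub_nonneg.2 hxy)]
      rw [← neg_sub]
      exact (neg_le_abs _).trans (hgen y hy x hx hxy
        (Ioo_subset_Icc_self.trans Icc_subset_uIcc'))
  set B := √|y - x| * √(C / k m ^ 2)
  -- As `f x = 0`, the logarithms of `f y + ε` and `ε` differ by at most `B`, which does not depend
  -- on `ε`; letting `ε → 0` gives `f y = 0`.
  have hle : ∀ ε > 0, f y + ε ≤ ε * Real.exp B := by
    intro ε hε
    have hpos : 0 < f y + ε := by have := hf0 y hy; positivity
    have := key ε hε
    rw [hfx, zero_add] at this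
    rw [← Real.exp_log hpos, ← Real.exp_log (x := ε) hε, ← Real.exp_add, Real.exp_log hε]
    exact Real.exp_le_exp.2 (by linarith)
  refine le_antisymm ?_ (hf0 y hy)
  refine le_of_forall_pos_le_add fun δ hδ => ?_
  have hB := Real.exp_pos B
  have := hle (δ / Real.exp B) (by positivity)
  rw [div_mul_cancel₀ _ hB.ne'] at this
  have : 0 < δ / Real.exp B := by positivity
  linarith

end ArcEstimates

/-! ### Weak compactness and lower semicontinuity on one arc -/

section ArcLimit

open Filter Topology

/-- A bounded sequence in a Hilbert space has a weak limit along any ultrafilter. -/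
theorem Ultrafilter.exists_weak_limit {F : Type*} [NormedAddCommGroup F] [InnerProductSpace ℝ F]
    [CompleteSpace F] {ι : Type*} (U : Ultrafilter ι) {v : ι → F} {C : ℝ} (hv : ∀ n, ‖v n‖ ≤ C) :
    ∃ w : F, ∀ x, Tendsto (fun n => inner ℝ (v n) x) U (𝓝 (inner ℝ w x)) := by
  -- By Riesz the sequence lies in a closed ball of the dual, which is weak-* compact by
  -- Banach–Alaoglu; along an ultrafilter no subsequence has to be extracted.
  let Φ : ι → WeakDual ℝ F := fun n => StrongDual.toWeakDual (InnerProductSpace.toDual ℝ F (v n))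
  obtain ⟨l, -, hl⟩ := (WeakDual.isCompact_closedBall (𝕜 := ℝ) (E := F) 0 C).ultrafilter_le_nhds'
    (U.map Φ) (Ultrafilter.mem_map.2 (Filter.univ_mem' fun n => mem_closedBall_zero_iff.2 <|
       ((InnerProductSpace.toDual ℝ F).norm_map (v n)).trans_le (hv n)))
  refine ⟨(InnerProductSpace.toDual ℝ F).symm (WeakDual.toStrongDual l), fun x => ?_⟩
  rw [InnerProductSpace.toDual_symm_apply]
  have h1 : Tendsto (fun φ : WeakDual ℝ F => φ x) (𝓝 l) (𝓝 (l x)) :=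
    (WeakDual.eval_continuous x).tendsto l
  exact h1.comp (show Tendsto Φ U (𝓝 l) from hl)

theorem Ultrafilter.exists_tendsto_of_abs_le {ι : Type*} (U : Ultrafilter ι) {a : ι → ℝ} {C : ℝ}
    (ha : ∀ n, |a n| ≤ C) : ∃ l, Tendsto a U (𝓝 l) := by
  obtain ⟨l, -, hl⟩ := (isCompact_Icc (a := -C) (b := C)).ultrafilter_le_nhds' (U.map a)
    (Ultrafilter.mem_map.2 (Filter.univ_mem' fun n => abs_le.1 (ha n)))
  exact ⟨l, hl⟩

/-- Pass to the limit in `2⟪v n, w⟫ - ‖w‖² ≤ ‖v n‖²`. -/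
theorem norm_sq_le_of_weak_limit {F : Type*} [NormedAddCommGroup F] [InnerProductSpace ℝ F]
    {ι : Type*} {U : Filter ι} [U.NeBot] {v : ι → F} {w : F} {D : ℝ}
    (h : ∀ x, Tendsto (fun n => inner ℝ (v n) x) U (𝓝 (inner ℝ w x)))
    (hD : Tendsto (fun n => ‖v n‖ ^ 2) U (𝓝 D)) : ‖w‖ ^ 2 ≤ D := by
  have h1 : Tendsto (fun n => 2 * inner ℝ (v n) w - ‖w‖ ^ 2) U (𝓝 (2 * inner ℝ w w - ‖w‖ ^ 2)) :=
    ((h w).const_mul 2).sub_const _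
  have h2 := le_of_tendsto_of_tendsto' h1 hD fun n => by
    nlinarith [real_inner_le_norm (v n) w, sq_nonneg (‖v n‖ - ‖w‖)]
  rw [real_inner_self_eq_norm_sq] at h2
  linarith

variable {s t : Set ℝ}

/-- Convergence of integrals of equi-Hölder bounded functions converging pointwise. -/
theorem IsArc.tendsto_integral_comp (h : IsArc s t) {ι : Type*} {U : Filter ι} {f : ι → ℝ → ℝ}
    {g Φ : ℝ → ℝ} (hΦ : Continuous Φ) (hf : ∀ n, ArcH1 (f n) s t) {C B : ℝ}
    (hC : ∀ n, ∫ x in s, deriv (f n) x ^ 2 ≤ C) (hB : ∀ n, ∀ x ∈ t, |f n x| ≤ B)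
    (hgB : ∀ x ∈ t, |g x| ≤ B) (hgc : ContinuousOn g t)
    (hlim : ∀ x ∈ t, Tendsto (fun n => f n x) U (𝓝 (g x))) {x : ℝ} (hx : x ∈ t) :
    Tendsto (fun n => ∫ z in (0 : ℝ)..x, Φ (f n z)) U (𝓝 (∫ z in (0 : ℝ)..x, Φ (g z))) := by
  have hx0 := h.nonneg hx
  have hsub : Icc 0 x ⊆ t := h.ordConnected.out h.zero_mem hx
  -- The derivative bound gives a common Hölder modulus of exponent 1/2, and equicontinuity on a
  -- compact interval upgrades pointwise to uniform convergence along any filter.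
  have heq : Equicontinuous fun n (z : Icc 0 x) => f n z := by
    refine Metric.equicontinuous_of_continuity_modulus (fun r => √r * √C) ?_ _ fun y z n => ?_
    · have : Continuous fun r => √r * √C := by fun_prop
      simpa using this.tendsto 0
    · rw [dist_comm, Real.dist_eq, Subtype.dist_eq, dist_comm, Real.dist_eq]
      refine ((hf n).abs_sub_le h (hsub y.2) (hsub z.2)).trans ?_
      gcongr
      exact hC n
  have hunif : TendstoUniformly (fun n (z : Icc 0 x) => f n z) (fun z => g z) U := by
    have := (heq.tendsto_uniformFun_iff_pi U fun z : Icc 0 x => g z).2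
      (tendsto_pi_nhds.2 fun z => hlim z (hsub z.2))
    exact UniformFun.tendsto_iff_tendstoUniformly.1 this
  have hunif' := UniformContinuousOn.comp_tendstoUniformly (s := Icc (-B) B)
    (F := fun n (z : Icc 0 x) => f n z) (f := fun z => g z)
    (fun n z => abs_le.1 (hB n z (hsub z.2))) (fun z => abs_le.1 (hgB z (hsub z.2)))
    (isCompact_Icc.uniformContinuousOn_of_continuous hΦ.continuousOn) hunif
  rw [Metric.tendsto_nhds]
  intro ε hε
  -- `x + 1` because `x` may be 0.
  have hδ : 0 < ε / (x + 1) := by positivity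
  filter_upwards [Metric.tendstoUniformly_iff.1 hunif' _ hδ] with n hn
  have hi : ∀ u : ℝ → ℝ, ContinuousOn u t →
      IntervalIntegrable (fun z => Φ (u z)) volume 0 x := fun u hu =>
    h.intervalIntegrable_of_continuousOn (hΦ.comp_continuousOn hu) h.zero_mem hx
  rw [dist_eq_norm, ← intervalIntegral.integral_sub (hi _ ((hf n).ac.continuousOn h)) (hi _ hgc)]
  refine lt_of_le_of_lt (intervalIntegral.norm_integral_le_of_norm_le_const (C := ε / (x + 1))
    fun z hz => ?_) ?_
  · rw [uIoc_of_le hx0] at hz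
    have := hn ⟨z, Ioc_subset_Icc_self hz⟩
    rw [dist_comm] at this
    exact this.le
  · rw [sub_zero, abs_of_nonneg hx0, div_mul_eq_mul_div, div_lt_iff₀ (by positivity)]
    nlinarith

theorem IsArc.integral_eq_setIntegral (h : IsArc s t) {x : ℝ} (hx : x ∈ t) (F : ℝ → ℝ) :
    ∫ z in (0 : ℝ)..x, F z = ∫ z in Ioo 0 x, F z ∂(volume.restrict s) := by
  rw [Measure.restrict_restrict measurableSet_Ioo,
    inter_eq_left.2 (h.Ioo_subset h.zero_mem hx), intervalIntegral.integral_of_le (h.nonneg hx),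
    integral_Ioc_eq_integral_Ioo]

/-- Weak limits in `L²` of an arc converge against indicators of initial intervals. -/
theorem IsArc.tendsto_integral_of_weak_limit (h : IsArc s t) {ι : Type*} {U : Filter ι}
    {f : ι → ℝ → ℝ} (hf : ∀ n, MemLp (f n) 2 (volume.restrict s))
    {w : Lp ℝ 2 (volume.restrict s)}
    (hw : ∀ x, Tendsto (fun n => inner ℝ ((hf n).toLp (f n)) x) U (𝓝 (inner ℝ w x))) {x : ℝ}
    (hx : x ∈ t) :
    Tendsto (fun n => ∫ z in (0 : ℝ)..x, f n z) U (𝓝 (∫ z in (0 : ℝ)..x, w z)) := by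
  have hfin : (volume.restrict s) (Ioo 0 x) ≠ ⊤ :=
    ((Measure.restrict_apply_le _ _).trans_lt (by simp)).ne
  have := hw (indicatorConstLp 2 (measurableSet_Ioo (a := 0) (b := x)) hfin (1 : ℝ))
  rw [real_inner_comm, L2.inner_indicatorConstLp_one, ← h.integral_eq_setIntegral hx] at this
  refine this.congr fun n => ?_
  rw [real_inner_comm, L2.inner_indicatorConstLp_one, h.integral_eq_setIntegral hx]
  exact integral_congr_ae (ae_restrict_of_ae (hf n).coeFn_toLp)

/-- Weak compactness and lower semicontinuity in `H¹` of an arc. -/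
theorem IsArc.arcH1_limit (h : IsArc s t) {ι : Type*} (U : Ultrafilter ι) {f : ι → ℝ → ℝ}
    {g : ℝ → ℝ} (hf : ∀ n, ArcH1 (f n) s t) {C B M D : ℝ}
    (hC : ∀ n, ∫ x in s, deriv (f n) x ^ 2 ≤ C) (hC' : ∀ n, ∫ x in s, f n x ^ 2 ≤ C)
    (hB : ∀ n, ∀ x ∈ t, |f n x| ≤ B)
    (hlim : ∀ x ∈ t, Tendsto (fun n => f n x) U (𝓝 (g x)))
    (hM : Tendsto (fun n => ∫ x in s, f n x ^ 2) U (𝓝 M))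
    (hD : Tendsto (fun n => ∫ x in s, deriv (f n) x ^ 2) U (𝓝 D)) :
    ArcH1 g s t ∧ ∫ x in s, g x ^ 2 ≤ M ∧ ∫ x in s, deriv g x ^ 2 ≤ D := by
  have hbd : ∀ {u : ι → ℝ → ℝ} (hu : ∀ n, MemLp (u n) 2 (volume.restrict s)),
      (∀ n, ∫ x in s, u n x ^ 2 ≤ C) → ∀ n, ‖(hu n).toLp (u n)‖ ≤ √C := fun hu hle n => by
    rw [(hu n).norm_toLp_eq_sqrt_integral]
    exact Real.sqrt_le_sqrt (hle n)
  obtain ⟨w, hw⟩ := U.exists_weak_limit (hbd (fun n => (hf n).memLp_deriv) hC)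
  obtain ⟨v, hv⟩ := U.exists_weak_limit (hbd (fun n => (hf n).memLp) hC')
  have hw2 := norm_sq_le_of_weak_limit hw (D := D)
    (by simpa only [MemLp.norm_toLp_sq_eq_integral] using hD)
  have hv2 := norm_sq_le_of_weak_limit hv (D := M)
    (by simpa only [MemLp.norm_toLp_sq_eq_integral] using hM)
  have hnorm : ∀ (u : Lp ℝ 2 (volume.restrict s)) (f : ℝ → ℝ), f =ᵐ[volume.restrict s] u →
      ∫ x in s, f x ^ 2 = ‖u‖ ^ 2 := fun u f hfu => by
    have e := (Lp.memLp u).norm_toLp_sq_eq_integral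
    rw [Lp.toLp_coeFn] at e
    rw [e]
    refine integral_congr_ae ?_
    filter_upwards [hfu] with x hx
    rw [hx]
  -- Limit of the fundamental theorem of calculus for `f n`: the weak limit `w` of the derivatives
  -- is the derivative of `g`.
  have hgw : ∀ x ∈ t, g x = g 0 + ∫ z in (0 : ℝ)..x, w z := fun x hx => by
    refine tendsto_nhds_unique (hlim x hx) (((hlim 0 h.zero_mem).add
      (h.tendsto_integral_of_weak_limit (fun n => (hf n).memLp_deriv) hw hx)).congr fun n => ?_)
    rw [(hf n).ac.integral_deriv h.zero_mem hx]
    ring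
  obtain ⟨hac, hd⟩ := h.primitive (fun x hx =>
    h.intervalIntegrable_of_memLp (Lp.memLp w) h.zero_mem hx) hgw
  have hgc := hac.continuousOn h
  have hgB : ∀ x ∈ t, |g x| ≤ B := fun x hx =>
    le_of_tendsto (hlim x hx).abs (Eventually.of_forall fun n => hB n x hx)
  -- The pointwise limit `g` and the weak `L²` limit `v` have the same primitive, and
  -- differentiating it identifies them almost everywhere.
  have hgv : ∀ x ∈ t, ∫ z in (0 : ℝ)..x, g z = ∫ z in (0 : ℝ)..x, v z := fun x hx =>
    tendsto_nhds_unique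
      (h.tendsto_integral_comp (Φ := id) continuous_id hf hC hB hgB hgc hlim hx)
      (h.tendsto_integral_of_weak_limit (fun n => (hf n).memLp) hv hx)
  have h1 := (h.primitive (f := fun x => ∫ z in (0 : ℝ)..x, g z) (g := g)
    (fun x hx => h.intervalIntegrable_of_continuousOn hgc h.zero_mem hx) (by simp)).2
  have h2 := (h.primitive (f := fun x => ∫ z in (0 : ℝ)..x, g z) (g := v)
    (fun x hx => h.intervalIntegrable_of_memLp (Lp.memLp v) h.zero_mem hx)
    (fun x hx => by simpa using hgv x hx)).2
  have hae : g =ᵐ[volume.restrict s] v := h1.symm.trans h2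
  exact ⟨⟨hac, (Lp.memLp v).ae_eq hae.symm, (Lp.memLp w).ae_eq hd.symm⟩,
    (hnorm v g hae).trans_le hv2, (hnorm w _ hd).trans_le hw2⟩

end ArcLimit

/-! ### From arcs to the graph -/

section Graph

open Filter Topology

theorem LocallyACOn.congr {s t : Set ℝ} (h : IsArc s t) {f g : ℝ → ℝ} (hf : LocallyACOn f t)
    (hfg : EqOn f g t) : LocallyACOn g t := by
  intro x hx y hy
  have h2 := hf x hx y hy
  rw [absolutelyContinuousOnInterval_iff] at h2 ⊢
  intro ε hε
  obtain ⟨δ, hδ, h3⟩ := h2 ε hε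
  refine ⟨δ, hδ, fun A hA hA' => ?_⟩
  refine lt_of_eq_of_lt (Finset.sum_congr rfl fun i hi => ?_) (h3 A hA hA')
  have hm := hA.1 i hi
  rw [hfg (h.uIcc_subset hx hy hm.1), hfg (h.uIcc_subset hx hy hm.2)]

/-- Restrictions to arcs are clamped outside `t`, so explicit formulas match only on `t`; on the
open interior this suffices for derivatives. -/
theorem IsArc.deriv_eqOn {s t : Set ℝ} (h : IsArc s t) {f g : ℝ → ℝ} (hfg : EqOn f g t) :
    EqOn (deriv f) (deriv g) s := fun _ hx =>
  ((hfg.mono h.subset).eventuallyEq_of_mem (h.isOpen.mem_nhds hx)).deriv_eq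

theorem ArcH1.congr {s t : Set ℝ} (h : IsArc s t) {f g : ℝ → ℝ} (hf : ArcH1 f s t)
    (hfg : EqOn f g t) : ArcH1 g s t :=
  ⟨hf.ac.congr h hfg, hf.memLp.ae_eq (ae_restrict_of_forall_mem h.measurableSet
    fun _ hx => hfg (h.subset hx)), hf.memLp_deriv.ae_eq (ae_restrict_of_forall_mem
    h.measurableSet (h.deriv_eqOn hfg))⟩

namespace MetricGraph

variable {V E H : Type*} (G : MetricGraph V E H)

/-- The interior of the `i`-th arc. -/
def dom (i : E ⊕ H) : Set ℝ := Sum.elim (fun e => Ioo 0 (G.length e)) (fun _ => Ioi 0) i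

/-- The `i`-th arc, endpoints included. -/
def cdom (i : E ⊕ H) : Set ℝ := Sum.elim (fun e => Icc 0 (G.length e)) (fun _ => Ici 0) i

/-- The point with coordinate `x` on the `i`-th arc. -/
noncomputable def pt (i : E ⊕ H) (x : ℝ) : G.Point :=
  Sum.elim (fun e => G.edgePt e x) (fun h => G.rayPt h x) i

/-- The restriction of `u` to the `i`-th arc. -/
noncomputable def res (u : G.Point → ℝ) (i : E ⊕ H) : ℝ → ℝ := fun x => u (G.pt i x)

theorem pt_inl (e : E) (x : ℝ) : G.pt (Sum.inl e) x = G.edgePt e x := rfl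

theorem pt_inr (h : H) (x : ℝ) : G.pt (Sum.inr h) x = G.rayPt h x := rfl

theorem isArc (i : E ⊕ H) : IsArc (G.dom i) (G.cdom i) := by
  rcases i with e | h
  · exact Or.inl ⟨G.length e, G.length_pos e, rfl, rfl⟩
  · exact Or.inr ⟨rfl, rfl⟩

theorem exists_pt_eq (x : G.Point) : ∃ i, ∃ y ∈ G.cdom i, G.pt i y = x := by
  obtain ⟨⟨e, y⟩ | ⟨h, y⟩, rfl⟩ := Quot.exists_rep x
  · refine ⟨Sum.inl e, y, y.2, ?_⟩
    rw [pt_inl, edgePt, projIcc_val]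
  · refine ⟨Sum.inr h, y, y.2, ?_⟩
    rw [pt_inr, rayPt, projIci_coe]

theorem continuous_pt (i : E ⊕ H) : Continuous (G.pt i) := by
  rcases i with e | h
  · exact continuous_quot_mk.comp (continuous_inl.comp
      ((continuous_sigmaMk (σ := fun e => Icc (0 : ℝ) (G.length e)) (i := e)).comp
        (continuous_projIcc (h := (G.length_pos e).le))))
  · exact continuous_quot_mk.comp (continuous_inr.comp
      ((continuous_sigmaMk (σ := fun _ : H => Ici (0 : ℝ)) (i := h)).comp
        ((continuous_const.max continuous_id).subtype_mk _)))

/-- Universal property of the quotient topology. Compatibility at the vertices is automatic, since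
`u` is defined on the glued space. -/
theorem continuous_iff (u : G.Point → ℝ) :
    Continuous u ↔ ∀ i, ContinuousOn (G.res u i) (G.cdom i) := by
  refine ⟨fun hu i => (hu.comp (G.continuous_pt i)).continuousOn, fun hu => ?_⟩
  suffices h : Continuous fun a : G.PrePoint => u (Quot.mk _ a) from
    isQuotientMap_quot_mk.continuous_iff.2 h
  rw [continuous_sum_dom]
  constructor
  · refine continuous_sigma fun e => ?_
    have := continuousOn_iff_continuous_domRestrict.1 (hu (Sum.inl e))
    refine this.congr fun (x : Icc (0 : ℝ) (G.length e)) => ?_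
    change u (G.edgePt e x) = _
    rw [edgePt, projIcc_val]
    rfl
  · refine continuous_sigma fun h => ?_
    have := continuousOn_iff_continuous_domRestrict.1 (hu (Sum.inr h))
    refine this.congr fun (x : Ici (0 : ℝ)) => ?_
    change u (G.rayPt h x) = _
    rw [rayPt, projIci_coe]
    rfl

theorem mem_H1_iff (u : G.Point → ℝ) :
    u ∈ G.H1 ↔ ∀ i, ArcH1 (G.res u i) (G.dom i) (G.cdom i) := by
  constructor
  · rintro ⟨hc, hE, hH⟩ i
    have := (G.continuous_iff u).1 hc i
    rcases i with e | h
    · exact (hE e).arcH1 (G.isArc (Sum.inl e)) this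
    · exact (hH h).arcH1 (G.isArc (Sum.inr h)) this
  · intro hu
    exact ⟨(G.continuous_iff u).2 fun i => (hu i).ac.continuousOn (G.isArc i),
      fun e => (hu (Sum.inl e)).memH1On (G.isArc (Sum.inl e)),
      fun h => (hu (Sum.inr h)).memH1On (G.isArc (Sum.inr h))⟩

/-- A property that spreads along each arc spreads to the whole graph. -/
theorem forall_of_spread {P : G.Point → Prop}
    (hP : ∀ i, ∀ x ∈ G.cdom i, ∀ y ∈ G.cdom i, P (G.pt i x) → P (G.pt i y)) {x₀ : G.Point}
    (h₀ : P x₀) (x : G.Point) : P x := by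
  -- All endpoints at a vertex are one point of the graph, so `P` at one of them gives `Q` at that
  -- vertex; edges then transport `Q` through `connected`.
  let Q : V → Prop := fun v => ∀ a, G.IsEnd a v → P (Quot.mk _ a)
  have hQ : ∀ {v a}, G.IsEnd a v → P (Quot.mk _ a) → Q v := fun {v a} ha hPa b hb => by
    rwa [show (Quot.mk _ b : G.Point) = Quot.mk _ a from Quot.sound ⟨v, hb, ha⟩]
  have hsrc : ∀ e, G.pt (Sum.inl e) 0 = Quot.mk _ (Sum.inl ⟨e, 0, le_refl 0, (G.length_pos e).le⟩) :=
    fun e => by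
      rw [pt_inl, edgePt, projIcc_left]
  have htgt : ∀ e, G.pt (Sum.inl e) (G.length e) =
      Quot.mk _ (Sum.inl ⟨e, G.length e, (G.length_pos e).le, le_refl _⟩) := fun e => by
    rw [pt_inl, edgePt, projIcc_right]
  have hroot : ∀ h, G.pt (Sum.inr h) 0 = Quot.mk _ (Sum.inr ⟨h, 0, self_mem_Ici⟩) := fun h => by
    rw [pt_inr, rayPt, projIci_self]
  have m0 : ∀ i, (0 : ℝ) ∈ G.cdom i := fun i => (G.isArc i).zero_mem
  have ml : ∀ e, G.length e ∈ G.cdom (Sum.inl e) := fun e => ⟨(G.length_pos e).le, le_rfl⟩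
  have hedge : ∀ e, Q (G.src e) ↔ Q (G.tgt e) := fun e => by
    constructor
    · intro h
      refine hQ (.tgt e) ?_
      rw [← htgt]
      exact hP _ 0 (m0 _) _ (ml e) (hsrc e ▸ h _ (.src e))
    · intro h
      refine hQ (.src e) ?_
      rw [← hsrc]
      exact hP _ _ (ml e) 0 (m0 _) (htgt e ▸ h _ (.tgt e))
  have hall : ∀ v w, Q v ↔ Q w := fun v w => by
    induction G.connected v w with
    | rel a b h =>
      obtain ⟨e, rfl, rfl⟩ := h
      exact hedge e
    | refl => rfl
    | symm _ _ _ ih => exact ih.symm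
    | trans _ _ _ _ _ ih1 ih2 => exact ih1.trans ih2
  have hex : ∃ v, Q v := by
    obtain ⟨i, y, hy, rfl⟩ := G.exists_pt_eq x₀
    have := hP i y hy 0 (m0 i) h₀
    rcases i with e | h
    · exact ⟨_, hQ (.src e) (hsrc e ▸ this)⟩
    · exact ⟨_, hQ (.root h) (hroot h ▸ this)⟩
  obtain ⟨v, hv⟩ := hex
  obtain ⟨i, y, hy, rfl⟩ := G.exists_pt_eq x
  refine hP i 0 (m0 i) y hy ?_
  rcases i with e | h
  · rw [hsrc]; exact (hall v _).1 hv _ (.src e)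
  · rw [hroot]; exact (hall v _).1 hv _ (.root h)

/-! ### Scaling, exponential cutoffs and the bound `infEnergy ≤ 0` -/

theorem const_mul_mem_H1 {u : G.Point → ℝ} (hu : u ∈ G.H1) (c : ℝ) :
    (fun x => c * u x) ∈ G.H1 := by
  rw [mem_H1_iff] at hu ⊢
  exact fun i => ((hu i).const_mul (G.isArc i) c).1

/-- Every endpoint receives the value 1, which makes `expCutoff` well defined on the quotient. -/
theorem elim_one_exp_eq_one (ε : ℝ) {a : G.PrePoint} {v : V} (ha : G.IsEnd a v) :
    Sum.elim (fun _ => (1 : ℝ)) (fun q : Σ _ : H, Ici (0 : ℝ) => Real.exp (-ε * q.2.1)) a = 1 := by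
  cases ha <;> simp

/-- The function `1` on the bounded edges and `exp (-ε x)` on the half-lines. -/
noncomputable def expCutoff (ε : ℝ) : G.Point → ℝ :=
  Quot.lift (Sum.elim (fun _ => 1) fun q => Real.exp (-ε * q.2.1)) fun _ _ ⟨_, ha, hb⟩ =>
    (G.elim_one_exp_eq_one ε ha).trans (G.elim_one_exp_eq_one ε hb).symm

theorem res_expCutoff_inl (ε : ℝ) (e : E) : G.res (G.expCutoff ε) (Sum.inl e) = fun _ => 1 := rfl

theorem res_expCutoff_inr (ε : ℝ) (h : H) :
    EqOn (fun x => Real.exp (-ε * x)) (G.res (G.expCutoff ε) (Sum.inr h)) (Ici 0) := fun x hx => by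
  have : G.res (G.expCutoff ε) (Sum.inr h) x = Real.exp (-ε * (projIci 0 x : Ici (0 : ℝ))) := rfl
  rw [this, projIci_of_mem hx]

theorem integrableOn_exp_sq {ε : ℝ} (hε : 0 < ε) :
    IntegrableOn (fun x => Real.exp (-ε * x) ^ 2) (Ioi 0) ∧
      ∫ x in Ioi 0, Real.exp (-ε * x) ^ 2 = 1 / (2 * ε) := by
  have e : ∀ x, Real.exp (-ε * x) ^ 2 = Real.exp (-(2 * ε) * x) := fun x => by
    rw [← Real.exp_nat_mul]; ring_nf
  simp only [e]
  refine ⟨integrableOn_exp_mul_Ioi (by linarith) 0, ?_⟩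
  rw [integral_exp_mul_Ioi (by linarith)]
  simp

theorem arcH1_exp {ε : ℝ} (hε : 0 < ε) : ArcH1 (fun x => Real.exp (-ε * x)) (Ioi 0) (Ici 0) := by
  have hd : deriv (fun x => Real.exp (-ε * x)) = fun x => -ε * Real.exp (-ε * x) := by
    ext x
    simpa [mul_comm] using (((hasDerivAt_id x).const_mul (-ε)).exp).deriv
  have hm : MemLp (fun x => Real.exp (-ε * x)) 2 (volume.restrict (Ioi 0)) :=
    (memLp_two_iff_integrable_sq (by fun_prop)).2 (integrableOn_exp_sq hε).1
  refine ⟨fun x _ y _ => ContDiffOn.absolutelyContinuousOnInterval (ContDiff.contDiffOn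
    (by fun_prop)), hm, ?_⟩
  rw [hd]
  exact hm.const_mul _

theorem expCutoff_mem_H1 {ε : ℝ} (hε : 0 < ε) : G.expCutoff ε ∈ G.H1 := by
  rw [mem_H1_iff]
  rintro (e | h)
  · rw [res_expCutoff_inl]
    refine ⟨fun x _ y _ => contDiffOn_const.absolutelyContinuousOnInterval, ?_, ?_⟩
    · have : IsFiniteMeasure (volume.restrict (G.dom (Sum.inl e))) :=
        inferInstanceAs (IsFiniteMeasure (volume.restrict (Ioo 0 (G.length e))))
      exact memLp_const 1
    · simp
  · exact (arcH1_exp hε).congr (G.isArc (Sum.inr h)) (G.res_expCutoff_inr ε h)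

variable [Fintype E]

/-- The nonlinear part `‖u‖^p` of the energy. -/
noncomputable def potential (p : ℝ) (u : G.Point → ℝ) : ℝ :=
  ∑ e, ∫ x in Ioo 0 (G.length e), |G.onEdge u e x| ^ p

theorem potential_nonneg (p : ℝ) (u : G.Point → ℝ) : 0 ≤ G.potential p u :=
  Finset.sum_nonneg fun _ _ => integral_nonneg fun _ => by positivity

theorem potential_const_mul (p : ℝ) (u : G.Point → ℝ) {c : ℝ} (hc : 0 ≤ c) :
    G.potential p (fun x => c * u x) = c ^ p * G.potential p u := by
  simp only [potential, Finset.mul_sum, ← integral_const_mul, onEdge, abs_mul, abs_of_nonneg hc]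
  simp only [Real.mul_rpow hc (abs_nonneg _)]

variable [Fintype H]

theorem energy_eq (p : ℝ) (u : G.Point → ℝ) :
    G.energy p u = 1 / 2 * G.dirichlet u - 1 / p * G.potential p u := rfl

theorem mass_eq (u : G.Point → ℝ) : G.mass u = ∑ i, ∫ x in G.dom i, G.res u i x ^ 2 := by
  rw [Fintype.sum_sum_type]
  simp only [mass, sq_abs]
  rfl

theorem dirichlet_eq {u : G.Point → ℝ} (hu : u ∈ G.H1) :
    G.dirichlet u = ∑ i, ∫ x in G.dom i, deriv (G.res u i) x ^ 2 := by
  rw [Fintype.sum_sum_type]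
  simp only [dirichlet, sq_abs]
  have := (G.mem_H1_iff u).1 hu
  have key : ∀ i, ∫ x in G.dom i, weakDerivOn (G.res u i) (G.dom i) x ^ 2 =
      ∫ x in G.dom i, deriv (G.res u i) x ^ 2 := fun i => by
    refine integral_congr_ae ?_
    filter_upwards [(this i).weakDerivOn_ae_eq (G.isArc i)] with x hx
    rw [hx]
  exact congrArg₂ (· + ·) (Finset.sum_congr rfl fun e _ => key (Sum.inl e))
    (Finset.sum_congr rfl fun h _ => key (Sum.inr h))

theorem setIntegral_sq_le_mass (u : G.Point → ℝ) (i : E ⊕ H) :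
    ∫ x in G.dom i, G.res u i x ^ 2 ≤ G.mass u := by
  rw [mass_eq]
  exact Finset.single_le_sum (f := fun i => ∫ x in G.dom i, G.res u i x ^ 2)
    (fun i _ => integral_nonneg fun _ => sq_nonneg _) (Finset.mem_univ i)

theorem setIntegral_deriv_sq_le_dirichlet {u : G.Point → ℝ} (hu : u ∈ G.H1) (i : E ⊕ H) :
    ∫ x in G.dom i, deriv (G.res u i) x ^ 2 ≤ G.dirichlet u := by
  rw [G.dirichlet_eq hu]
  exact Finset.single_le_sum (f := fun i => ∫ x in G.dom i, deriv (G.res u i) x ^ 2)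
    (fun i _ => integral_nonneg fun _ => sq_nonneg _) (Finset.mem_univ i)

theorem mass_nonneg (u : G.Point → ℝ) : 0 ≤ G.mass u := by
  rw [mass_eq]
  exact Finset.sum_nonneg fun i _ => integral_nonneg fun _ => sq_nonneg _

theorem dirichlet_nonneg {u : G.Point → ℝ} (hu : u ∈ G.H1) : 0 ≤ G.dirichlet u := by
  rw [G.dirichlet_eq hu]
  exact Finset.sum_nonneg fun i _ => integral_nonneg fun _ => sq_nonneg _

theorem mass_const_mul (u : G.Point → ℝ) (c : ℝ) : G.mass (fun x => c * u x) = c ^ 2 * G.mass u := by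
  simp only [mass_eq, Finset.mul_sum, ← integral_const_mul, res, mul_pow]

theorem dirichlet_const_mul {u : G.Point → ℝ} (hu : u ∈ G.H1) (c : ℝ) :
    G.dirichlet (fun x => c * u x) = c ^ 2 * G.dirichlet u := by
  rw [G.dirichlet_eq hu, G.dirichlet_eq (G.const_mul_mem_H1 hu c), Finset.mul_sum]
  refine Finset.sum_congr rfl fun i _ => ?_
  rw [← integral_const_mul]
  refine integral_congr_ae ?_
  filter_upwards [(((G.mem_H1_iff u).1 hu i).const_mul (G.isArc i) c).2] with x hx
  rw [← mul_pow]
  exact congrArg (· ^ 2) hx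

theorem mass_expCutoff {ε : ℝ} (hε : 0 < ε) :
    G.mass (G.expCutoff ε) = ∑ e, G.length e + Fintype.card H / (2 * ε) := by
  rw [mass_eq, Fintype.sum_sum_type]
  congr 1
  · refine Finset.sum_congr rfl fun e _ => ?_
    rw [res_expCutoff_inl]
    simp [dom, (G.length_pos e).le]
  · have : ∀ h, ∫ x in G.dom (Sum.inr h), G.res (G.expCutoff ε) (Sum.inr h) x ^ 2 =
        1 / (2 * ε) := fun h => by
      rw [← (integrableOn_exp_sq hε).2]
      exact setIntegral_congr_fun measurableSet_Ioi fun x hx => by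
        rw [← G.res_expCutoff_inr ε h (mem_Ici_of_Ioi hx)]
    simp only [this]
    simp [div_eq_mul_inv]

theorem dirichlet_expCutoff {ε : ℝ} (hε : 0 < ε) :
    G.dirichlet (G.expCutoff ε) = Fintype.card H * (ε / 2) := by
  rw [G.dirichlet_eq (G.expCutoff_mem_H1 hε), Fintype.sum_sum_type]
  have h1 : ∀ e, ∫ x in G.dom (Sum.inl e), deriv (G.res (G.expCutoff ε) (Sum.inl e)) x ^ 2 = 0 :=
    fun e => by
      rw [res_expCutoff_inl]; simp
  have h2 : ∀ h, ∫ x in G.dom (Sum.inr h), deriv (G.res (G.expCutoff ε) (Sum.inr h)) x ^ 2 =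
      ε / 2 := fun h => by
    have hd : deriv (fun x => Real.exp (-ε * x)) = fun x => -ε * Real.exp (-ε * x) := by
      ext x
      simpa [mul_comm] using (((hasDerivAt_id x).const_mul (-ε)).exp).deriv
    have : ∫ x in G.dom (Sum.inr h), deriv (G.res (G.expCutoff ε) (Sum.inr h)) x ^ 2 =
        ∫ x in Ioi 0, ε ^ 2 * Real.exp (-ε * x) ^ 2 :=
      setIntegral_congr_fun measurableSet_Ioi fun x hx => by
        rw [← (G.isArc (Sum.inr h)).deriv_eqOn (G.res_expCutoff_inr ε h) hx, hd]
        ring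
    rw [this, integral_const_mul, (integrableOn_exp_sq hε).2]
    field_simp
  simp only [h1, h2]
  simp

theorem infEnergy_le {p μ : ℝ} {u : G.Point → ℝ} (hu : u ∈ G.H1Mass μ) :
    G.infEnergy p μ ≤ G.energy p u :=
  iInf₂_le u hu

/-- Rescaling a function to a prescribed mass. -/
theorem sqrt_mul_mem_H1Mass {u : G.Point → ℝ} (hu : u ∈ G.H1) (hm : 0 < G.mass u) {μ : ℝ}
    (hμ : 0 < μ) : (fun x => √(μ / G.mass u) * u x) ∈ G.H1Mass μ := by
  refine ⟨G.const_mul_mem_H1 hu _, ?_⟩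
  rw [mass_const_mul, Real.sq_sqrt (by positivity), div_mul_cancel₀ _ hm.ne']

/-- The mass of `expCutoff ε` is at least the total length `L` of the bounded edges and its
Dirichlet integral is `k * ε / 2`, so its rescaling to mass `μ` has kinetic energy of order `ε`. -/
theorem infEnergy_nonpos {p μ : ℝ} (hp : 0 < p) (hμ : 0 < μ) : G.infEnergy p μ ≤ 0 := by
  by_contra hcon
  obtain ⟨r, hr0, hr⟩ := EReal.lt_iff_exists_real_btwn.1 (not_le.1 hcon)
  have hr0' : 0 < r := by exact_mod_cast hr0
  have hL : 0 < ∑ e, G.length e := by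
    have := G.nontrivial
    exact Finset.sum_pos (fun e _ => G.length_pos e) Finset.univ_nonempty
  set L := ∑ e, G.length e
  set k : ℝ := (Fintype.card H : ℝ)
  have hk : 0 ≤ k := Nat.cast_nonneg _
  -- Makes `μ / L * k * ε < r`; the `+ 1` covers the case `k = 0` of no half-lines.
  set ε : ℝ := r / (μ / L * k + 1) with hε'
  have hε : 0 < ε := by positivity
  have hmL : L ≤ G.mass (G.expCutoff ε) := by
    rw [G.mass_expCutoff hε]
    have : 0 ≤ k / (2 * ε) := by positivity
    linarith
  have hm : 0 < G.mass (G.expCutoff ε) := hL.trans_le hmL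
  have hu := G.expCutoff_mem_H1 hε
  have h1 := hr.trans_le (G.infEnergy_le (p := p) (G.sqrt_mul_mem_H1Mass hu hm hμ))
  have h2 : r < G.energy p fun x => √(μ / G.mass (G.expCutoff ε)) * G.expCutoff ε x := by
    exact_mod_cast h1
  rw [energy_eq, G.dirichlet_const_mul hu, G.dirichlet_expCutoff hε,
    Real.sq_sqrt (by positivity)] at h2
  have h3 : 0 ≤ 1 / p * G.potential p
      fun x => √(μ / G.mass (G.expCutoff ε)) * G.expCutoff ε x :=
    mul_nonneg (by positivity) (G.potential_nonneg _ _)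
  have h4 : μ / G.mass (G.expCutoff ε) * (k * (ε / 2)) ≤ μ / L * (k * (ε / 2)) := by gcongr
  have h5 : ε * (μ / L * k + 1) = r := div_mul_cancel₀ _ (by positivity)
  nlinarith [mul_nonneg (div_nonneg hμ.le hL.le) hk]

end MetricGraph

end Graph

/-! ### Coercivity and existence of minimizers -/

section Existence

open Filter Topology

/-- For `q < 2` the square dominates beyond some `Y`; below it `Y ^ q` is enough. -/
theorem exists_rpow_le_mul_sq_add {q η : ℝ} (hq0 : 0 < q) (hq : q < 2) (hη : 0 < η) :
    ∃ C, ∀ y : ℝ, 0 ≤ y → y ^ q ≤ η * y ^ 2 + C := by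
  have h1 := (tendsto_rpow_neg_atTop (sub_pos.2 hq)).eventually_le_const hη
  obtain ⟨Y, hY⟩ := eventually_atTop.1 (h1.and (eventually_gt_atTop 0))
  have hY0 := (hY Y le_rfl).2
  refine ⟨Y ^ q, fun y hy => ?_⟩
  rcases le_total y Y with h | h
  · have := Real.rpow_le_rpow hy h hq0.le
    nlinarith [mul_nonneg hη.le (sq_nonneg y)]
  · have hy0 := hY0.trans_le h
    have e : y ^ q = y ^ 2 * y ^ (-(2 - q)) := by
      rw [← Real.rpow_natCast y 2, ← Real.rpow_add hy0]
      norm_num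
    have := (hY y h).1
    have h2 : 0 ≤ Y ^ q := by positivity
    rw [e]
    nlinarith [mul_le_mul_of_nonneg_left this (sq_nonneg y)]

namespace MetricGraph

variable {V E H : Type*} (G : MetricGraph V E H)

theorem integrableOn_res_abs_rpow {p : ℝ} (hp : 0 ≤ p) {u : G.Point → ℝ} (hu : Continuous u)
    (e : E) : IntegrableOn (fun x => |G.onEdge u e x| ^ p) (Ioo 0 (G.length e)) := by
  have hc : Continuous fun x => |G.onEdge u e x| ^ p :=
    (hu.comp (G.continuous_pt (Sum.inl e))).abs.rpow_const fun _ => Or.inr hp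
  exact hc.continuousOn.integrableOn_Icc.mono_set Ioo_subset_Icc_self

variable [Fintype E] [Fintype H]

/-- Interpolation: `|u| ^ p ≤ S ^ (p - 2) * |u| ^ 2`. -/
theorem potential_le {p S : ℝ} (hp : 2 ≤ p) {u : G.Point → ℝ} (hu : u ∈ G.H1)
    (hS : ∀ x, |u x| ≤ S) : G.potential p u ≤ S ^ (p - 2) * G.mass u := by
  have h1 : ∑ e, ∫ x in Ioo 0 (G.length e), |G.onEdge u e x| ^ 2 ≤ G.mass u :=
    le_add_of_nonneg_right (Finset.sum_nonneg fun _ _ => integral_nonneg fun _ => by positivity)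
  have hS0 : 0 ≤ S := by
    obtain ⟨e⟩ := G.nontrivial
    exact (abs_nonneg _).trans (hS (G.edgePt e 0))
  refine le_trans ?_ (mul_le_mul_of_nonneg_left h1 (by positivity))
  rw [Finset.mul_sum]
  refine Finset.sum_le_sum fun e _ => ?_
  rw [← integral_const_mul]
  have h2 : IntegrableOn (fun x => |G.onEdge u e x| ^ 2) (Ioo 0 (G.length e)) := by
    simpa using G.integrableOn_res_abs_rpow (p := 2) (by norm_num) hu.1 e
  refine integral_mono (G.integrableOn_res_abs_rpow (by linarith) hu.1 e) (h2.const_mul _)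
    fun x => ?_
  have h3 : |G.onEdge u e x| ≤ S := hS _
  calc |G.onEdge u e x| ^ p = |G.onEdge u e x| ^ (p - 2) * |G.onEdge u e x| ^ 2 := by
        rw [← Real.rpow_natCast _ 2, ← Real.rpow_add_of_nonneg (abs_nonneg _) (by linarith)
          (by norm_num)]
        norm_num
    _ ≤ S ^ (p - 2) * |G.onEdge u e x| ^ 2 := by
        gcongr

/-- The Gagliardo–Nirenberg inequality on a metric graph. -/
theorem exists_sq_le : ∃ A ≥ 0, ∀ u ∈ G.H1, ∀ x,
    u x ^ 2 ≤ A * G.mass u + 2 * (√(G.mass u) * √(G.dirichlet u)) := by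
  choose d hd hd0 using fun i => (G.isArc i).exists_pos
  refine ⟨∑ i, 1 / d i, Finset.sum_nonneg fun i _ => (one_div_pos.2 (hd0 i)).le,
    fun u hu x => ?_⟩
  obtain ⟨i, y, hy, rfl⟩ := G.exists_pt_eq x
  have h1 := ((G.mem_H1_iff u).1 hu i).sq_le (G.isArc i) (hd i) (hd0 i) hy
  have h2 := G.setIntegral_sq_le_mass u i
  have h3 := G.setIntegral_deriv_sq_le_dirichlet hu i
  have h4 : 1 / d i ≤ ∑ i, 1 / d i := Finset.single_le_sum (f := fun i => 1 / d i)
    (fun i _ => (one_div_pos.2 (hd0 i)).le) (Finset.mem_univ i)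
  refine h1.trans (add_le_add ?_ ?_)
  · rw [div_eq_mul_one_div, mul_comm]
    exact mul_le_mul h4 h2 (integral_nonneg fun _ => sq_nonneg _)
      ((one_div_pos.2 (hd0 i)).le.trans h4)
  · gcongr

/-- The energy controls the Dirichlet integral on functions of given mass. -/
theorem exists_dirichlet_le {p μ : ℝ} (hp₂ : 2 < p) (hp₆ : p < 6) (hμ : 0 < μ) :
    ∃ C, ∀ u ∈ G.H1Mass μ, G.dirichlet u ≤ 4 * G.energy p u + C := by
  obtain ⟨A, hA, hAu⟩ := G.exists_sq_le
  -- The potential is bounded by `μ * y ^ ((p - 2) / 2)` with `y²` at most linear in `D`; the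
  -- exponent is below 2 exactly because `p < 6`. This `η` makes the share of `D` in `potential / p`
  -- equal to `D / 4`, half of the kinetic term.
  have hη : 0 < p / (32 * μ ^ 2) := by positivity
  obtain ⟨C, hC⟩ := exists_rpow_le_mul_sq_add (q := (p - 2) / 2) (by linarith) (by linarith) hη
  refine ⟨(A * μ) ^ 2 / (4 * μ) + 4 * (μ / p) * C, fun u hu => ?_⟩
  obtain ⟨hu1, hum⟩ := hu
  have hD := G.dirichlet_nonneg hu1
  set D := G.dirichlet u
  set y := A * μ + 2 * (√μ * √D) with hy
  have hy0 : 0 ≤ y := by positivity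
  have h1 : G.potential p u ≤ √y ^ (p - 2) * μ := by
    have := G.potential_le hp₂.le hu1 (S := √y) fun x => Real.le_sqrt_of_sq_le (by
      rw [sq_abs]
      simpa only [hum] using hAu u hu1 x)
    rwa [hum] at this
  have e1 : √y ^ (p - 2) = y ^ ((p - 2) / 2) := by
    rw [Real.sqrt_eq_rpow, ← Real.rpow_mul hy0]
    ring_nf
  have h2 : y ^ 2 ≤ 2 * (A * μ) ^ 2 + 8 * (μ * D) := by
    have h3 : (√μ * √D) ^ 2 = μ * D := by
      rw [mul_pow, Real.sq_sqrt hμ.le, Real.sq_sqrt hD]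
    nlinarith [sq_nonneg (A * μ - 2 * (√μ * √D))]
  have h4 : G.potential p u ≤ (p / (32 * μ ^ 2) * (2 * (A * μ) ^ 2 + 8 * (μ * D)) + C) * μ := by
    refine h1.trans ?_
    rw [e1]
    have := hC y hy0
    have := mul_le_mul_of_nonneg_left h2 hη.le
    gcongr
    linarith
  have h5 : 1 / p * G.potential p u ≤ (A * μ) ^ 2 / (16 * μ) + D / 4 + μ / p * C := by
    refine (mul_le_mul_of_nonneg_left h4 (by positivity : 0 ≤ 1 / p)).trans (le_of_eq ?_)
    have : p ≠ 0 := by linarith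
    field_simp
    ring
  have e2 : (A * μ) ^ 2 / (4 * μ) = 4 * ((A * μ) ^ 2 / (16 * μ)) := by
    field_simp
    ring
  rw [energy_eq, e2]
  linarith

/-- The limit of a minimizing sequence may have lost mass. For `σ ≥ 1` and `p > 2` the energy of `σ
v` is at most `σ²` times that of `v`, so at negative energy restoring the mass only helps. -/
theorem exists_isMinimizer {p μ : ℝ} (hp₂ : 2 < p) (hp₆ : p < 6) (hμ : 0 < μ)
    (hneg : G.infEnergy p μ < 0) : ∃ u, G.IsMinimizer p μ u := by
  obtain ⟨C, hC⟩ := G.exists_dirichlet_le hp₂ hp₆ hμ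
  obtain ⟨A, hA, hAu⟩ := G.exists_sq_le
  have hp0 : 0 < p := by linarith
  -- Coercivity bounds the energy below, so the infimum is a real number.
  have hbelow : ((-C / 4 : ℝ) : EReal) ≤ G.infEnergy p μ :=
    le_iInf₂ fun u hu => EReal.coe_le_coe_iff.2 (by
      linarith [hC u hu, G.dirichlet_nonneg hu.1])
  obtain ⟨m, hm⟩ : ∃ m : ℝ, G.infEnergy p μ = m :=
    ⟨_, (EReal.coe_toReal (hneg.trans EReal.zero_lt_top).ne
      ((EReal.bot_lt_coe _).trans_le hbelow).ne').symm⟩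
  have hm0 : m < 0 := by
    rw [hm] at hneg
    exact_mod_cast hneg
  have hle : ∀ u ∈ G.H1Mass μ, m ≤ G.energy p u := fun u hu => by
    have := G.infEnergy_le (p := p) hu
    rw [hm] at this
    exact_mod_cast this
  have hseq : ∀ n : ℕ, ∃ u ∈ G.H1Mass μ, G.energy p u < m + 1 / (n + 1) := fun n => by
    have h1 : G.infEnergy p μ < ((m + 1 / (n + 1) : ℝ) : EReal) := by
      rw [hm, EReal.coe_lt_coe_iff]
      have : (0 : ℝ) < 1 / (n + 1) := by positivity
      linarith
    simp only [infEnergy, iInf_lt_iff, EReal.coe_lt_coe_iff, exists_prop] at h1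
    exact h1
  choose u hu hun using hseq
  set U := hyperfilter ℕ
  have hUtop : (U : Filter ℕ) ≤ atTop := Nat.hyperfilter_le_atTop
  have hE : Tendsto (fun n => G.energy p (u n)) U (𝓝 m) := by
    refine (tendsto_of_tendsto_of_tendsto_of_le_of_le tendsto_const_nhds ?_
      (fun n => hle _ (hu n)) fun n => (hun n).le).mono_left hUtop
    simpa using tendsto_one_div_add_atTop_nhds_zero_nat.const_add m
  set D₀ := 4 * (m + 1) + C
  have hD₀ : ∀ n, G.dirichlet (u n) ≤ D₀ := fun n => by
    have h1 : (1 : ℝ) / (n + 1) ≤ 1 := by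
      rw [div_le_one (by positivity)]
      linarith [n.cast_nonneg (α := ℝ)]
    linarith [hC _ (hu n), hun n]
  have hB : ∀ n x, |u n x| ≤ √(A * μ + 2 * (√μ * √D₀)) := fun n x => by
    refine Real.le_sqrt_of_sq_le ?_
    rw [sq_abs]
    have := hAu _ (hu n).1 x
    rw [(hu n).2] at this
    refine this.trans ?_
    gcongr
    exact hD₀ n
  set B := √(A * μ + 2 * (√μ * √D₀))
  choose v hv using fun x => U.exists_tendsto_of_abs_le (a := fun n => u n x) fun n => hB n x
  have hvB : ∀ x, |v x| ≤ B := fun x =>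
    le_of_tendsto (hv x).abs (Eventually.of_forall fun n => hB n x)
  have hmi : ∀ i n, ∫ x in G.dom i, G.res (u n) i x ^ 2 ≤ max μ D₀ := fun i n =>
    ((G.setIntegral_sq_le_mass _ i).trans_eq (hu n).2).trans (le_max_left _ _)
  have hdi : ∀ i n, ∫ x in G.dom i, deriv (G.res (u n) i) x ^ 2 ≤ max μ D₀ := fun i n =>
    ((G.setIntegral_deriv_sq_le_dirichlet (hu n).1 i).trans (hD₀ n)).trans (le_max_right _ _)
  choose M hM using fun i => U.exists_tendsto_of_abs_le
    (a := fun n => ∫ x in G.dom i, G.res (u n) i x ^ 2) fun n => by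
      rw [abs_of_nonneg (integral_nonneg fun _ => sq_nonneg _)]
      exact hmi i n
  choose D hD using fun i => U.exists_tendsto_of_abs_le
    (a := fun n => ∫ x in G.dom i, deriv (G.res (u n) i) x ^ 2) fun n => by
      rw [abs_of_nonneg (integral_nonneg fun _ => sq_nonneg _)]
      exact hdi i n
  have hlim := fun i => (G.isArc i).arcH1_limit U (f := fun n => G.res (u n) i) (g := G.res v i)
    (fun n => (G.mem_H1_iff _).1 (hu n).1 i) (hdi i) (hmi i) (fun n x _ => hB n _)
    (fun x _ => hv _) (hM i) (hD i)
  have hvH1 : v ∈ G.H1 := (G.mem_H1_iff v).2 fun i => (hlim i).1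
  have hmass : G.mass v ≤ μ := by
    have h1 : Tendsto (fun n => G.mass (u n)) U (𝓝 (∑ i, M i)) := by
      simp only [mass_eq]
      exact tendsto_finsetSum _ fun i _ => hM i
    have h2 : ∑ i, M i = μ := tendsto_nhds_unique h1 (by
      simp only [(hu _).2]
      exact tendsto_const_nhds)
    rw [mass_eq, ← h2]
    exact Finset.sum_le_sum fun i _ => (hlim i).2.1
  -- No potential is lost at infinity: only bounded edges contribute, and there the convergence is
  -- uniform.
  have hpot : Tendsto (fun n => G.potential p (u n)) U (𝓝 (G.potential p v)) := by
    refine tendsto_finsetSum _ fun e _ => ?_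
    have h1 := (G.isArc (Sum.inl e)).tendsto_integral_comp (Φ := fun y => |y| ^ p)
      (continuous_abs.rpow_const fun _ => Or.inr hp0.le)
      (fun n => (G.mem_H1_iff _).1 (hu n).1 (Sum.inl e)) (hdi _) (fun n x _ => hB n _)
      (fun x _ => hvB _) ((hlim _).1.ac.continuousOn (G.isArc _)) (fun x _ => hv _)
      (x := G.length e) ⟨(G.length_pos e).le, le_rfl⟩
    simp only [intervalIntegral.integral_of_le (G.length_pos e).le,
      integral_Ioc_eq_integral_Ioo] at h1
    exact h1
  have hEv : G.energy p v ≤ m := by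
    have h1 : Tendsto (fun n => G.dirichlet (u n)) U (𝓝 (∑ i, D i)) := by
      simp only [fun n => G.dirichlet_eq (hu n).1]
      exact tendsto_finsetSum _ fun i _ => hD i
    have h2 := tendsto_nhds_unique hE ((h1.const_mul (1 / 2)).sub (hpot.const_mul (1 / p)))
    have h3 : G.dirichlet v ≤ ∑ i, D i := by
      rw [G.dirichlet_eq hvH1]
      exact Finset.sum_le_sum fun i _ => (hlim i).2.2
    rw [h2, energy_eq]
    linarith
  have hvD := G.dirichlet_nonneg hvH1
  have hvN := G.potential_nonneg p v
  -- Zero mass would kill the potential and leave a nonnegative energy, against `m < 0`.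
  have hmass0 : 0 < G.mass v := by
    refine (G.mass_nonneg v).lt_of_ne fun h0 => ?_
    have h1 := G.potential_le hp₂.le hvH1 hvB
    rw [← h0, mul_zero] at h1
    have h2 : G.potential p v = 0 := le_antisymm h1 hvN
    rw [energy_eq, h2] at hEv
    linarith
  have hw := G.sqrt_mul_mem_H1Mass hvH1 hmass0 hμ
  refine ⟨_, hw, le_antisymm ?_ (G.infEnergy_le hw)⟩
  rw [hm, EReal.coe_le_coe_iff, energy_eq, G.dirichlet_const_mul hvH1,
    G.potential_const_mul p v (Real.sqrt_nonneg _)]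
  set σ := √(μ / G.mass v)
  have hσ : 1 ≤ σ := Real.one_le_sqrt.2 ((one_le_div hmass0).2 hmass)
  have hσp : σ ^ 2 ≤ σ ^ p := by
    rw [← Real.rpow_natCast]
    exact Real.rpow_le_rpow_of_exponent_le hσ (by exact_mod_cast hp₂.le)
  have h1 : 1 / p * (σ ^ 2 * G.potential p v) ≤ 1 / p * (σ ^ p * G.potential p v) := by gcongr
  have h2 : σ ^ 2 * G.energy p v ≤ m := by
    nlinarith [mul_nonneg (sub_nonneg.2 (one_le_pow₀ hσ (n := 2))) (by linarith : 0 ≤ -G.energy p v)]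
  rw [energy_eq] at h2
  linarith

end MetricGraph

end Existence

/-! ### Strict positivity of minimizers up to sign -/

section Positivity

open Filter Topology

theorem ArcH1.integral_add_const_mul_sq {s t : Set ℝ} (h : IsArc s t) {f g : ℝ → ℝ}
    (hf : ArcH1 f s t) (hg : ArcH1 g s t) (c : ℝ) :
    ∫ x in s, (f x + c * g x) ^ 2 = (∫ x in s, f x ^ 2) + 2 * c * (∫ x in s, f x * g x) +
        c ^ 2 * ∫ x in s, g x ^ 2 ∧
      ∫ x in s, deriv (fun x => f x + c * g x) x ^ 2 = (∫ x in s, deriv f x ^ 2) +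
        2 * c * (∫ x in s, deriv f x * deriv g x) + c ^ 2 * ∫ x in s, deriv g x ^ 2 := by
  have key : ∀ {f g : ℝ → ℝ}, MemLp f 2 (volume.restrict s) → MemLp g 2 (volume.restrict s) →
      ∫ x in s, (f x + c * g x) ^ 2 = (∫ x in s, f x ^ 2) + 2 * c * (∫ x in s, f x * g x) +
        c ^ 2 * ∫ x in s, g x ^ 2 := fun {f g} hf hg => by
    have hfg : Integrable (fun x => f x * g x) (volume.restrict s) := hf.integrable_mul hg
    have e : ∀ x, (f x + c * g x) ^ 2 = f x ^ 2 + 2 * c * (f x * g x) + c ^ 2 * g x ^ 2 :=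
      fun x => by ring
    simp only [e]
    have hs : Integrable (fun x => f x ^ 2 + 2 * c * (f x * g x)) (volume.restrict s) :=
      hf.integrable_sq.add (hfg.const_mul _)
    rw [integral_add hs (hg.integrable_sq.const_mul _),
      integral_add hf.integrable_sq (hfg.const_mul _), integral_const_mul, integral_const_mul]
  refine ⟨key hf.memLp hg.memLp, ?_⟩
  rw [← key hf.memLp_deriv hg.memLp_deriv]
  refine integral_congr_ae ?_
  filter_upwards [(hf.add_const_mul h hg c).2] with x hx
  rw [hx]

namespace MetricGraph

variable {V E H : Type*} (G : MetricGraph V E H)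

theorem expCutoff_pos_le_one {ε : ℝ} (hε : 0 < ε) (x : G.Point) :
    0 < G.expCutoff ε x ∧ G.expCutoff ε x ≤ 1 := by
  obtain ⟨_ | ⟨h, y⟩, rfl⟩ := Quot.exists_rep x
  · exact ⟨one_pos, le_rfl⟩
  · have hy : (0 : ℝ) ≤ y := y.2
    exact ⟨Real.exp_pos _, Real.exp_le_one_iff.2 (by nlinarith)⟩

/-- By the intermediate value theorem positivity cannot be lost along an arc without meeting a zero.
-/
theorem forall_pos_of_ne_zero {u : G.Point → ℝ} (hu : Continuous u) (h0 : ∀ x, u x ≠ 0)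
    {x₀ : G.Point} (hx₀ : 0 < u x₀) (x : G.Point) : 0 < u x := by
  refine G.forall_of_spread (P := fun x => 0 < u x) (fun i x hx y hy h => ?_) hx₀ x
  by_contra hcon
  obtain ⟨z, -, hz⟩ := (G.isArc i).ordConnected.isPreconnected.intermediate_value hy hx
    ((G.continuous_iff u).1 hu i) ⟨not_lt.1 hcon, h.le⟩
  exact h0 _ hz

theorem add_const_mul_mem_H1 {u φ : G.Point → ℝ} (hu : u ∈ G.H1) (hφ : φ ∈ G.H1) (c : ℝ) :
    (fun x => u x + c * φ x) ∈ G.H1 := by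
  rw [mem_H1_iff] at *
  exact fun i => ((hu i).add_const_mul (G.isArc i) (hφ i) c).1

variable [Fintype E]

theorem potential_mono {p : ℝ} (hp : 0 ≤ p) {u v : G.Point → ℝ} (hu : Continuous u)
    (hv : Continuous v) (huv : ∀ x, |u x| ≤ |v x|) : G.potential p u ≤ G.potential p v :=
  Finset.sum_le_sum fun e _ => integral_mono (G.integrableOn_res_abs_rpow hp hu e)
    (G.integrableOn_res_abs_rpow hp hv e) fun _ =>
      Real.rpow_le_rpow (abs_nonneg _) (huv _) hp

variable [Fintype H]

/-- The absolute value of a minimizer is a minimizer. -/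
theorem IsMinimizer.abs {p μ : ℝ} {u : G.Point → ℝ} (hu : G.IsMinimizer p μ u) :
    G.IsMinimizer p μ fun x => |u x| := by
  have hu1 := (G.mem_H1_iff u).1 hu.1.1
  have hmem : (fun x => |u x|) ∈ G.H1 :=
    (G.mem_H1_iff _).2 fun i => ((hu1 i).abs (G.isArc i)).1
  have hmass : (fun x => |u x|) ∈ G.H1Mass μ := by
    refine ⟨hmem, ?_⟩
    rw [← hu.1.2, mass_eq, mass_eq]
    simp only [res, sq_abs]
  refine ⟨hmass, le_antisymm ?_ (G.infEnergy_le hmass)⟩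
  rw [← hu.2, EReal.coe_le_coe_iff, energy_eq, energy_eq]
  have h1 : G.potential p (fun x => |u x|) = G.potential p u := by
    simp only [potential, onEdge, abs_abs]
  have h2 : G.dirichlet (fun x => |u x|) ≤ G.dirichlet u := by
    rw [G.dirichlet_eq hmem, G.dirichlet_eq hu.1.1]
    exact Finset.sum_le_sum fun i _ => ((hu1 i).abs (G.isArc i)).2
  rw [h1]
  linarith

theorem mass_add_const_mul {u φ : G.Point → ℝ} (hu : u ∈ G.H1) (hφ : φ ∈ G.H1) (c : ℝ) :
    G.mass (fun x => u x + c * φ x) = G.mass u +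
      2 * c * (∑ i, ∫ x in G.dom i, G.res u i x * G.res φ i x) + c ^ 2 * G.mass φ := by
  simp only [mass_eq, Finset.mul_sum, ← Finset.sum_add_distrib]
  exact Finset.sum_congr rfl fun i _ => (((G.mem_H1_iff u).1 hu i).integral_add_const_mul_sq
    (G.isArc i) ((G.mem_H1_iff φ).1 hφ i) c).1

theorem dirichlet_add_const_mul {u φ : G.Point → ℝ} (hu : u ∈ G.H1) (hφ : φ ∈ G.H1) (c : ℝ) :
    G.dirichlet (fun x => u x + c * φ x) = G.dirichlet u +
      2 * c * (∑ i, ∫ x in G.dom i, deriv (G.res u i) x * deriv (G.res φ i) x) +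
        c ^ 2 * G.dirichlet φ := by
  rw [G.dirichlet_eq hu, G.dirichlet_eq hφ, G.dirichlet_eq (G.add_const_mul_mem_H1 hu hφ c)]
  simp only [Finset.mul_sum, ← Finset.sum_add_distrib]
  exact Finset.sum_congr rfl fun i _ => (((G.mem_H1_iff u).1 hu i).integral_add_const_mul_sq
    (G.isArc i) ((G.mem_H1_iff φ).1 hφ i) c).2

/-- The Dirichlet integral of a competitor lying above a nonnegative minimizer. -/
theorem IsMinimizer.dirichlet_sub_le {p μ : ℝ} (hp : 2 < p) (hμ : 0 < μ) {u v : G.Point → ℝ}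
    (hu : G.IsMinimizer p μ u) (hv : v ∈ G.H1) (huv : ∀ x, |u x| ≤ |v x|)
    (hm : μ ≤ G.mass v) :
    G.dirichlet u - G.potential p u / μ * (G.mass v - μ) ≤ G.dirichlet v := by
  have hm0 : 0 < G.mass v := hμ.trans_le hm
  have hw := G.sqrt_mul_mem_H1Mass hv hm0 hμ
  have h1 := hu.2.trans_le (G.infEnergy_le (p := p) hw)
  rw [EReal.coe_le_coe_iff, energy_eq, energy_eq, G.dirichlet_const_mul hv,
    G.potential_const_mul p v (Real.sqrt_nonneg _), Real.sq_sqrt (by positivity)] at h1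
  have e1 : √(μ / G.mass v) ^ p = (μ / G.mass v) ^ (p / 2) := by
    rw [Real.sqrt_eq_rpow, ← Real.rpow_mul (by positivity)]
    ring_nf
  rw [e1] at h1
  set r := μ / G.mass v with hr
  have hr0 : 0 < r := by positivity
  have hr1 : r ≤ 1 := (div_le_one hm0).2 hm
  -- Bernoulli's inequality linearizes the potential of the rescaled competitor, so the energy need
  -- not be differentiated.
  have hber : 1 + p / 2 * (r - 1) ≤ r ^ (p / 2) := by
    have := one_add_mul_self_le_rpow_one_add (s := r - 1) (by linarith) (p := p / 2) (by linarith)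
    simpa using this
  have hN := G.potential_mono (p := p) (by linarith) hu.1.1.1 hv.1 huv
  have hN0 := G.potential_nonneg p u
  have hD0 := G.dirichlet_nonneg hu.1.1
  have h2 : (1 + p / 2 * (r - 1)) * G.potential p u ≤ r ^ (p / 2) * G.potential p v :=
    (mul_le_mul_of_nonneg_right hber hN0).trans (mul_le_mul_of_nonneg_left hN (by positivity))
  have h3 : 1 / p * ((1 + p / 2 * (r - 1)) * G.potential p u) =
      1 / p * G.potential p u + 1 / 2 * (r - 1) * G.potential p u := by
    have : p ≠ 0 := by linarith
    field_simp
  have h4 := mul_le_mul_of_nonneg_left h2 (by positivity : 0 ≤ 1 / p)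
  have h5 : G.dirichlet u - (1 - r) * G.potential p u ≤ r * G.dirichlet v := by
    rw [h3] at h4
    linarith
  have h6 : r * (G.potential p u / μ * (G.mass v - μ)) = (1 - r) * G.potential p u := by
    rw [hr]
    field_simp
  have h7 : r * (G.dirichlet u - G.potential p u / μ * (G.mass v - μ)) ≤ r * G.dirichlet v := by
    rw [mul_sub, h6]
    nlinarith
  exact le_of_mul_le_mul_left h7 hr0

/-- A nonnegative minimizer is a weak supersolution of a linear equation. -/
theorem IsMinimizer.supersolution {p μ : ℝ} (hp : 2 < p) (hμ : 0 < μ) {u φ : G.Point → ℝ}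
    (hu : G.IsMinimizer p μ u) (hu0 : ∀ x, 0 ≤ u x) (hφ : φ ∈ G.H1) (hφ0 : ∀ x, 0 ≤ φ x) :
    0 ≤ (∑ i, ∫ x in G.dom i, deriv (G.res u i) x * deriv (G.res φ i) x) +
      G.potential p u / μ * ∑ i, ∫ x in G.dom i, G.res u i x * G.res φ i x := by
  set B₁ := ∑ i, ∫ x in G.dom i, deriv (G.res u i) x * deriv (G.res φ i) x
  set B₀ := ∑ i, ∫ x in G.dom i, G.res u i x * G.res φ i x with hB₀
  have hB₀' : 0 ≤ B₀ := Finset.sum_nonneg fun i _ => integral_nonneg fun x =>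
    mul_nonneg (hu0 _) (hφ0 _)
  set l := G.potential p u / μ
  -- The competitor is `u + cφ`. Both quadratic forms are expanded, `c` is divided out, and `c → 0+`
  -- leaves the first-order term.
  have key : ∀ c > 0, 0 ≤ 2 * (B₁ + l * B₀) + c * (G.dirichlet φ + l * G.mass φ) := by
    intro c hc
    have hM := G.mass_add_const_mul hu.1.1 hφ c
    have hmφ := G.mass_nonneg φ
    rw [← hB₀, hu.1.2] at hM
    have h1 := hu.dirichlet_sub_le G hp hμ (G.add_const_mul_mem_H1 hu.1.1 hφ c) (fun x => by
      have := mul_nonneg hc.le (hφ0 x)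
      rw [abs_of_nonneg (hu0 x), abs_of_nonneg (add_nonneg (hu0 x) this)]
      linarith) (by rw [hM]; nlinarith [mul_nonneg hc.le hB₀', mul_nonneg (sq_nonneg c) hmφ])
    rw [hM, G.dirichlet_add_const_mul hu.1.1 hφ c] at h1
    refine nonneg_of_mul_nonneg_right (a := c) ?_ hc
    nlinarith
  have hlim : Tendsto (fun c : ℝ => 2 * (B₁ + l * B₀) + c * (G.dirichlet φ + l * G.mass φ))
      (𝓝[>] 0) (𝓝 (2 * (B₁ + l * B₀) + 0 * (G.dirichlet φ + l * G.mass φ))) :=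
    (Continuous.tendsto (by fun_prop) 0).mono_left nhdsWithin_le_nhds
  have := ge_of_tendsto hlim (eventually_mem_nhdsWithin.mono fun c hc => key c hc)
  linarith

/-- The logarithmic derivative estimate for nonnegative minimizers. -/
theorem IsMinimizer.log_deriv_bound {p μ : ℝ} (hp : 2 < p) (hμ : 0 < μ) {u η : G.Point → ℝ}
    (hu : G.IsMinimizer p μ u) (hu0 : ∀ x, 0 ≤ u x) (hη : η ∈ G.H1) (hη0 : ∀ x, |η x| ≤ 1)
    {ε : ℝ} (hε : 0 < ε) (i : E ⊕ H) :
    IntegrableOn (fun x => (G.res η i x * deriv (G.res u i) x * (G.res u i x + ε)⁻¹) ^ 2)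
        (G.dom i) ∧
      ∫ x in G.dom i, (G.res η i x * deriv (G.res u i) x * (G.res u i x + ε)⁻¹) ^ 2 ≤
        4 * G.dirichlet η + 2 * (G.potential p u / μ) * G.mass η := by
  have hu1 := (G.mem_H1_iff u).1 hu.1.1
  have hη1 := (G.mem_H1_iff η).1 hη
  have hφ := fun i => (hu1 i).sq_div_add (G.isArc i) (hη1 i) (fun x _ => hu0 _)
    (fun x _ => hη0 _) hε
  have hφH : (fun x => η x ^ 2 * (u x + ε)⁻¹) ∈ G.H1 := (G.mem_H1_iff _).2 fun i => (hφ i).1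
  have hpos : ∀ x, 0 < u x + ε := fun x => by have := hu0 x; positivity
  have hsup := hu.supersolution G hp hμ hu0 hφH fun x =>
    mul_nonneg (sq_nonneg _) (inv_pos.2 (hpos x)).le
  have hint : ∀ i, IntegrableOn (fun x =>
      (G.res η i x * deriv (G.res u i) x * (G.res u i x + ε)⁻¹) ^ 2) (G.dom i) := fun i => by
    have hmeas : AEStronglyMeasurable (fun x => G.res η i x * deriv (G.res u i) x *
        (G.res u i x + ε)⁻¹) (volume.restrict (G.dom i)) := by
      refine ((hη1 i).memLp.1.mul (hu1 i).memLp_deriv.1).mul ?_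
      exact ((hu1 i).memLp.1.aemeasurable.add_const ε).inv.aestronglyMeasurable
    refine ((hu1 i).memLp_deriv.const_mul ε⁻¹ |>.of_le hmeas (ae_of_all _ fun x => ?_)).integrable_sq
    have h1 : |G.res η i x| ≤ 1 := hη0 _
    have h2 : 0 < G.res u i x + ε := hpos _
    have h3 : (G.res u i x + ε)⁻¹ ≤ ε⁻¹ := by
      gcongr
      have : 0 ≤ G.res u i x := hu0 _
      linarith
    simp only [Real.norm_eq_abs, abs_mul]
    rw [abs_of_pos (inv_pos.2 h2), abs_of_pos (inv_pos.2 hε)]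
    calc |G.res η i x| * |deriv (G.res u i) x| * (G.res u i x + ε)⁻¹
        ≤ 1 * |deriv (G.res u i) x| * ε⁻¹ := by gcongr
      _ = _ := by ring
  refine ⟨hint i, ?_⟩
  -- With `a = η'` and `b = η u' / (u + ε)` the integrand is `2ab - b²`, and `(2a - b)² ≥ 0` bounds
  -- it by `2a² - b²/2`.
  have h1 : ∀ i, ∫ x in G.dom i, deriv (G.res u i) x *
      deriv (G.res (fun x => η x ^ 2 * (u x + ε)⁻¹) i) x ≤
      2 * (∫ x in G.dom i, deriv (G.res η i) x ^ 2) - 1 / 2 *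
        ∫ x in G.dom i, (G.res η i x * deriv (G.res u i) x * (G.res u i x + ε)⁻¹) ^ 2 := fun i => by
    rw [← integral_const_mul, ← integral_const_mul,
      ← integral_sub ((hη1 i).integrableOn_deriv_sq.const_mul 2) ((hint i).const_mul (1 / 2))]
    refine integral_mono_ae ((hu1 i).memLp_deriv.integrable_mul (hφ i).1.memLp_deriv)
      (((hη1 i).integrableOn_deriv_sq.const_mul 2).sub ((hint i).const_mul (1 / 2))) ?_
    filter_upwards [(hφ i).2] with x hx
    have hx' : deriv (G.res (fun x => η x ^ 2 * (u x + ε)⁻¹) i) x =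
      2 * G.res η i x * deriv (G.res η i) x * (G.res u i x + ε)⁻¹ -
        G.res η i x ^ 2 * deriv (G.res u i) x * ((G.res u i x + ε)⁻¹) ^ 2 := hx
    simp only [hx']
    nlinarith [sq_nonneg (2 * deriv (G.res η i) x -
      G.res η i x * deriv (G.res u i) x * (G.res u i x + ε)⁻¹)]
  have h2 : ∑ i, ∫ x in G.dom i, G.res u i x * G.res (fun x => η x ^ 2 * (u x + ε)⁻¹) i x ≤
      G.mass η := by
    rw [mass_eq]
    refine Finset.sum_le_sum fun i _ => integral_mono_ae
      ((hu1 i).memLp.integrable_mul (hφ i).1.memLp) (hη1 i).integrableOn_sq (ae_of_all _ fun x => ?_)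
    have h3 := hpos (G.pt i x)
    have h4 : u (G.pt i x) * (u (G.pt i x) + ε)⁻¹ ≤ 1 := by
      rw [← div_eq_mul_inv, div_le_one h3]
      linarith
    calc u (G.pt i x) * (η (G.pt i x) ^ 2 * (u (G.pt i x) + ε)⁻¹)
        = η (G.pt i x) ^ 2 * (u (G.pt i x) * (u (G.pt i x) + ε)⁻¹) := by ring
      _ ≤ η (G.pt i x) ^ 2 * 1 := by gcongr
      _ = _ := mul_one _
  have h3 := Finset.sum_le_sum fun i (_ : i ∈ Finset.univ) => h1 i
  rw [Finset.sum_sub_distrib, ← Finset.mul_sum, ← Finset.mul_sum, ← G.dirichlet_eq hη] at h3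
  have h4 : 0 ≤ G.potential p u / μ := div_nonneg (G.potential_nonneg p u) hμ.le
  have h5 := mul_le_mul_of_nonneg_left h2 h4
  have h6 := Finset.single_le_sum (f := fun i => ∫ x in G.dom i,
    (G.res η i x * deriv (G.res u i) x * (G.res u i x + ε)⁻¹) ^ 2)
    (fun i _ => integral_nonneg fun _ => sq_nonneg _) (Finset.mem_univ i)
  linarith

/-- The strong maximum principle for nonnegative minimizers. -/
theorem IsMinimizer.ne_zero_of_nonneg {p μ : ℝ} (hp : 2 < p) (hμ : 0 < μ) {u : G.Point → ℝ}
    (hu : G.IsMinimizer p μ u) (hu0 : ∀ x, 0 ≤ u x) (x : G.Point) : u x ≠ 0 := by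
  intro hx
  -- This weight is positive at every point of the graph, half-lines included, so one `η` serves all
  -- arcs.
  have hη := G.expCutoff_mem_H1 one_pos
  have hη1 := G.expCutoff_pos_le_one one_pos
  have hb := fun ε (hε : 0 < ε) => hu.log_deriv_bound G hp hμ hu0 hη (fun x => by
    rw [abs_of_pos (hη1 x).1]
    exact (hη1 x).2) hε
  have hzero := G.forall_of_spread (P := fun x => u x = 0) (fun i x hx y hy h =>
    ((G.mem_H1_iff u).1 hu.1.1 i).eq_zero_of_log_deriv_bound (G.isArc i) (fun x _ => hu0 _)
      ((G.continuous_iff _).1 hη.1 i) (fun x _ => (hη1 _).1) (fun ε hε => (hb ε hε i).2)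
      (fun ε hε => (hb ε hε i).1) hx hy h) hx
  have hm := hu.1.2
  rw [mass_eq] at hm
  simp only [res, hzero] at hm
  simp at hm
  exact hμ.ne hm

/-- The maximum principle applied to the minimizer `|u|` excludes zeros of `u`, and a continuous
function without zeros on a connected graph has one sign. -/
theorem IsMinimizer.pos_or_neg {p μ : ℝ} (hp : 2 < p) (hμ : 0 < μ) {u : G.Point → ℝ}
    (hu : G.IsMinimizer p μ u) : (∀ x, 0 < u x) ∨ ∀ x, u x < 0 := by
  have h0 : ∀ x, u x ≠ 0 := fun x =>
    abs_ne_zero.1 (hu.abs.ne_zero_of_nonneg G hp hμ (fun x => abs_nonneg _) x)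
  obtain ⟨e⟩ := G.nontrivial
  rcases (h0 (G.edgePt e 0)).lt_or_gt with h | h
  · exact Or.inr fun x => neg_pos.1 (G.forall_pos_of_ne_zero (u := fun x => -u x) hu.1.1.1.neg
      (fun x => neg_ne_zero.2 (h0 x)) (neg_pos.2 h) x)
  · exact Or.inl (G.forall_pos_of_ne_zero hu.1.1.1 h0 h)

end MetricGraph

end Positivity

theorem theorem3p1 {V E H : Type*} [Fintype E] [Fintype H] (G : MetricGraph V E H)
    (p μ : ℝ) (hp₂ : 2 < p) (hp₆ : p < 6) (hμ : 0 < μ) :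
    G.infEnergy p μ ≤ 0 ∧
      (G.infEnergy p μ < 0 →
        (∃ u, G.IsMinimizer p μ u) ∧
          ∀ u, G.IsMinimizer p μ u → (∀ x, 0 < u x) ∨ (∀ x, u x < 0)) :=
  ⟨G.infEnergy_nonpos (by linarith) hμ, fun h => ⟨G.exists_isMinimizer hp₂ hp₆ hμ h,
    fun _ hu => hu.pos_or_neg G hp₂ hμ⟩⟩
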